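/- (ZFC) Let $R$ be a valuation domain of cardinality $\aleph_1$ with quotient field $Q$, and let $A \subsetneq J$ be $R$-submodules of $Q$. Let $(r_\nu)_{\nu<\omega_1}$ be any sequence of nonzero elements of $Q$ such that $r_\nu \in r_\mu R$ for all $\mu<\nu$ and $J=\bigcup_{\nu<\omega_1} r_\nu^{-1}R$. Assume: (a) $J/A$ is essentially uncountable, that is, for every $\nu<\omega_1$ there is $\mu>\nu$ such that $r_\nu A/r_\mu A$ is uncountable; (b) $\Gamma_R(J/A)=1$. Here, for a limit ordinal $\delta<\omega_1$, put $J_\delta=\bigcup_{\nu<\delta} r_\nu^{-1}R$ and let $(A:J_\delta)=\{x\in R : xJ_\delta\subseteq A\}$ be the corresponding ideal of $R$; the ring $R/(A:J_\delta)$ carries the linear topology with basis of neighbourhoods of $0$ given by the images of $R\cap r_\nu A$ $(\nu<\delta)$; and $\Gamma_R(J/A)$ is the class of the set $\{\delta<\omega_1 : \delta \text{ is a limit ordinal and } R/(A:J_\delta) \text{ is not complete}\}$ under the equivalence relation on subsets of $\omega_1$ of having the same intersection with some closed unbounded set. The class of $\omega_1$ itself is denoted $1$, so the condition says that this set contains a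 closed unbounded subset of $\omega_1$. Then there is an $R$-module $U$ which is uniserial (its submodules are totally ordered by inclusion), is of type $J/A$, and is non-standard. Here $U$ is of type $J/A$ if there is a nonzero $a\in U$ with $J/A\cong D(a)/\mathrm{Ann}(a)$ as $R$-modules, where $\mathrm{Ann}(a)=\{r\in R : ra=0\}$ and $D(a)=\bigcup\{r^{-1}R : r\in R \text{ divides } a \text{ in } U\}\subseteq Q$; and $U$ is non-standard if it is not isomorphic to $J'/A'$ for any $R$-submodules $A'\subseteq J'$ of $Q$. -/

import Mathlib

universe u v

/-! ### Subsets of `ω₁` modulo the club filter -/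

/-- The well-ordered set `ω₁` of countable ordinals. -/
abbrev OmegaOne : Type := (Ordinal.omega 1 : Ordinal.{0}).ToType

theorem OmegaOne.cof_ne : Order.cof OmegaOne ≠ Cardinal.aleph0 := by
  rw [Ordinal.cof_toType, Cardinal.cof_omega_one]
  exact Cardinal.aleph0_lt_aleph_one.ne'

/-- Two subsets of `ω₁` are equivalent if they agree on a closed unbounded set. -/
def clubSetoid : Setoid (Set OmegaOne) where
  r S T := ∃ C : Set OmegaOne, IsClub C ∧ S ∩ C = T ∩ C
  iseqv :=
    { refl := fun _ => ⟨Set.univ, IsClub.univ, rfl⟩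
      symm := fun ⟨C, hC, h⟩ => ⟨C, hC, h.symm⟩
      trans := by
        rintro S T U ⟨C, hC, h⟩ ⟨D, hD, h'⟩
        refine ⟨C ∩ D, hC.inter OmegaOne.cof_ne hD, ?_⟩
        rw [← Set.inter_assoc, h, Set.inter_right_comm, h', Set.inter_assoc, Set.inter_comm D C] }

/-- The set `D(ω₁)` of equivalence classes of subsets of `ω₁`. -/
def ClubClass : Type := Quotient clubSetoid

/-- The class of a subset of `ω₁`. -/
def ClubClass.mk (S : Set OmegaOne) : ClubClass := Quotient.mk clubSetoid S

/-- The greatest class `1`: the class of `ω₁`, consisting of the sets that contain a club. -/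
instance : One ClubClass := ⟨ClubClass.mk Set.univ⟩

theorem ClubClass.mk_eq_one_iff (S : Set OmegaOne) :
    ClubClass.mk S = 1 ↔ ∃ C : Set OmegaOne, IsClub C ∧ C ⊆ S := by
  constructor
  · intro h
    obtain ⟨C, hC, h⟩ := Quotient.exact (s := clubSetoid) h
    refine ⟨C, hC, ?_⟩
    rw [Set.univ_inter] at h
    exact Set.inter_eq_right.mp h
  · rintro ⟨C, hC, h⟩
    exact Quotient.sound (s := clubSetoid)
      ⟨C, hC, by rw [Set.univ_inter]; exact Set.inter_eq_right.mpr h⟩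

/-! ### Uniserial modules, standard modules and types -/

/-- A module is uniserial if its submodules are totally ordered by inclusion. -/
def IsUniserial (R U : Type*) [CommRing R] [AddCommGroup U] [Module R U] : Prop :=
  ∀ M N : Submodule R U, M ≤ N ∨ N ≤ M

/-- The quotient `J/A` of two submodules of `Q` (used for `A ≤ J`). -/
abbrev StdModule {R Q : Type*} [CommRing R] [Field Q] [Algebra R Q] (J A : Submodule R Q) :
    Type _ :=
  J ⧸ A.submoduleOf J

/-- A module is standard (with respect to the quotient field `Q`) if it is isomorphic to `J/A` for
some submodules `A ≤ J` of `Q`. -/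
def IsStandard (R Q U : Type*) [CommRing R] [Field Q] [Algebra R Q]
    [AddCommGroup U] [Module R U] : Prop :=
  ∃ J A : Submodule R Q, A ≤ J ∧ Nonempty (U ≃ₗ[R] StdModule J A)

/-- `Ann(a) = {r ∈ R : r a = 0}`, seen as a submodule of `Q`. -/
def annIn {R : Type*} (Q : Type*) {U : Type*} [CommRing R] [Field Q] [Algebra R Q]
    [AddCommGroup U] [Module R U] (a : U) : Submodule R Q :=
  Submodule.map (Algebra.linearMap R Q) (Ideal.torsionOf R U a)

/-- `D(a) = ⋃ {r⁻¹ R : r ≠ 0 divides a in U}`, as a submodule of `Q`.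
(For `a ≠ 0` every divisor `r` of `a` is nonzero.) -/
def divSubmodule {R : Type*} (Q : Type*) {U : Type*} [CommRing R] [IsDomain R] [ValuationRing R]
    [Field Q] [Algebra R Q] [IsFractionRing R Q] [AddCommGroup U] [Module R U] (a : U) :
    Submodule R Q where
  carrier := {q | ∃ r : R, r ≠ 0 ∧ (∃ b : U, r • b = a) ∧
    ∃ s : R, q = (algebraMap R Q r)⁻¹ * algebraMap R Q s}
  zero_mem' := ⟨1, one_ne_zero, ⟨a, one_smul R a⟩, 0, by simp⟩
  add_mem' := by
    have key : ∀ r r' s s' c : R, r' ≠ 0 → r * c = r' →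
        (algebraMap R Q r)⁻¹ * algebraMap R Q s + (algebraMap R Q r')⁻¹ * algebraMap R Q s' =
          (algebraMap R Q r')⁻¹ * algebraMap R Q (c * s + s') := by
      intro r r' s s' c hr' hc
      have hr0 : algebraMap R Q r ≠ 0 := by
        intro h
        exact hr' (by rw [← hc, (IsFractionRing.to_map_eq_zero_iff).mp h, zero_mul])
      have hc0 : algebraMap R Q c ≠ 0 := by
        intro h
        exact hr' (by rw [← hc, (IsFractionRing.to_map_eq_zero_iff).mp h, mul_zero])
      rw [← hc]
      simp only [map_mul, map_add]
      field_simp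
    rintro _ _ ⟨r, hr, hb, s, rfl⟩ ⟨r', hr', hb', s', rfl⟩
    obtain ⟨c, hc | hc⟩ := ValuationRing.cond r r'
    · exact ⟨r', hr', hb', c * s + s', key r r' s s' c hr' hc⟩
    · exact ⟨r, hr, hb, c * s' + s, by rw [add_comm]; exact key r' r s' s c hr hc⟩
  smul_mem' := by
    rintro t _ ⟨r, hr, hb, s, rfl⟩
    exact ⟨r, hr, hb, t * s, by rw [Algebra.smul_def, map_mul]; ring⟩

/-- `U` is of type `J/A` if `J/A ≅ D(a)/Ann(a)` for a nonzero `a ∈ U`. -/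
def IsOfType {R Q : Type*} (U : Type*) [CommRing R] [IsDomain R] [ValuationRing R]
    [Field Q] [Algebra R Q] [IsFractionRing R Q] [AddCommGroup U] [Module R U]
    (J A : Submodule R Q) : Prop :=
  ∃ a : U, a ≠ 0 ∧ Nonempty (StdModule J A ≃ₗ[R] StdModule (divSubmodule (R := R) Q a) (annIn (R := R) Q a))

/-! ### The invariant `Γ` and essential uncountability -/

section Gamma

variable {R Q : Type*} [CommRing R] [Field Q] [Algebra R Q]

/-- The cyclic submodule `q⁻¹ R` of `Q`. -/
def invSpan (R : Type*) {Q : Type*} [CommRing R] [Field Q] [Algebra R Q] (q : Q) :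
    Submodule R Q :=
  Submodule.span R {q⁻¹}

/-- The submodule `q A` of `Q`. -/
def scaled (q : Q) (A : Submodule R Q) : Submodule R Q :=
  A.map (LinearMap.mulLeft R q)

/-- `(r_ν)` for `ν < ω₁` is a sequence of nonzero elements of `Q`, with `r_μ ∣ r_ν` (over `R`) for
`μ < ν`, such that `J = ⋃_ν r_ν⁻¹ R`. The union is that of a chain, so it is the supremum. -/
structure IsPresentation (J : Submodule R Q) (r : OmegaOne → Q) : Prop where
  ne_zero : ∀ ν, r ν ≠ 0
  dvd : ∀ μ ν, μ < ν → ∃ c : R, r ν = c • r μ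
  eq_iSup : J = ⨆ ν, invSpan R (r ν)

/-- `J_δ = ⋃_{ν < δ} r_ν⁻¹ R`. -/
def partialUnion (R : Type*) {Q : Type*} [CommRing R] [Field Q] [Algebra R Q]
    (r : OmegaOne → Q) (δ : OmegaOne) : Submodule R Q :=
  ⨆ ν : Set.Iio δ, invSpan R (r ν)

/-- The ideal `(A : J_δ)` of `R`: all `x ∈ R` with `x J_δ ⊆ A`. -/
def colonIdeal (A : Submodule R Q) (r : OmegaOne → Q) (δ : OmegaOne) : Ideal R :=
  Submodule.comap (Algebra.linearMap R Q) (A / partialUnion R r δ)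

/-- The neighbourhood of `0` in `R/(A : J_δ)` given by (the part in `R` of) `r_ν A`. -/
def nhdSubmodule (A : Submodule R Q) (r : OmegaOne → Q) (δ ν : OmegaOne) :
    Submodule R (R ⧸ colonIdeal A r δ) :=
  Submodule.map (Submodule.mkQ (colonIdeal A r δ))
    (Submodule.comap (Algebra.linearMap R Q) (scaled (r ν) A))

/-- The linear uniformity on a module `M` given by a family of submodules `V i`: the coarsest one
for which all maps `M → M / V i` to discrete modules are uniformly continuous. When the `V i` form
a chain, they are a basis of neighbourhoods of `0`. -/
abbrev linearUniformSpace {R M ι : Type*} [CommRing R] [AddCommGroup M] [Module R M] (V : ι → Submodule R M) :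
    UniformSpace M :=
  ⨅ i, UniformSpace.comap (V i).mkQ ⊥

/-- `R/(A : J_δ)` is complete in the linear topology in which the `r_ν A`, `ν < δ`, are a basis of
neighbourhoods of `0`. -/
def IsCompleteAt (A : Submodule R Q) (r : OmegaOne → Q) (δ : OmegaOne) : Prop :=
  @CompleteSpace (R ⧸ colonIdeal A r δ)
    (linearUniformSpace fun ν : Set.Iio δ => nhdSubmodule A r δ ν)

/-- `Γ_R(J/A)`, computed from a sequence `(r_ν)` presenting `J`: the class of the set of limit
ordinals `δ < ω₁` such that `R/(A : J_δ)` is not complete. -/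
def gammaInvariant (A : Submodule R Q) (r : OmegaOne → Q) : ClubClass :=
  ClubClass.mk {δ | Order.IsSuccLimit δ ∧ ¬ IsCompleteAt A r δ}

/-- `J/A` is essentially uncountable (with `(r_ν)` presenting `J`): for every `ν < ω₁` there is
`μ > ν` such that `r_ν A / r_μ A` is uncountable. -/
def IsEssentiallyUncountable (A : Submodule R Q) (r : OmegaOne → Q) : Prop :=
  ∀ ν, ∃ μ, ν < μ ∧ Uncountable (StdModule (scaled (r ν) A) (scaled (r μ) A))

end Gamma

/-! Put I_σ = R ∩ r_σ A. Multiplication by r_ρ/r_σ embeds R/I_σ in R/I_ρ, and the direct limit of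
these maps is J/A. Twist the maps by units e_{ρσ} that are coherent modulo I_σ. The new limit is
still uniserial, with the same annihilators and divisors, hence of type J/A. If it is standard, the
twist is a coboundary: there are units c_ρ with c_ρ e_{ρσ} ≡ c_σ mod I_σ for all σ ≤ ρ
(`exists_cofinalBranch_of_isStandard`). It is therefore enough to find a coherent system without
such a cofinal branch.

The system is built by recursion. Row τ has to be a branch through the system below τ; one exists
because τ is countable (`IsCoherentOn.exists_branch`), and it may be multiplied by any Cauchy family
of units. How this freedom is used depends on the continuum.

If ℵ₁ < 2^ℵ₀, essential uncountability yields a binary tree of Cauchy families below a limit of type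
ω. There are more of them than units of R, so one of them defeats every unit at once, and row τ can
be chosen to rule out every cofinal branch whose values below τ are listed before τ
(`exists_coherent_of_lt_continuum`). Any cofinal branch would be ruled out at a closure point.

If 2^ℵ₀ = ℵ₁, the condition Γ = 1 provides Cauchy families without limit below the points of a club.
A function η : ω₁ → 2 decides at which of these points to twist. If every resulting system had a
cofinal branch, weak diamond would give two functions that first differ at some δ and whose branches
agree below δ; the quotient of the two branches at δ would then be a limit of the family at δ
(`exists_coherent_of_continuum_le`). -/

/-! ### Countable ordinals: bounds, ladders and closure points -/

namespace OmegaOne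

theorem mk_eq : Cardinal.mk OmegaOne = Cardinal.aleph 1 := by
  rw [Cardinal.mk_toType, Ordinal.card_omega]

instance : Nonempty OmegaOne := by
  rw [← Cardinal.mk_ne_zero_iff, mk_eq]
  exact (Cardinal.aleph_pos 1).ne'

theorem countable_Iio (a : OmegaOne) : (Set.Iio a).Countable := by
  have h : Cardinal.mk (Set.Iio a) < Cardinal.mk OmegaOne := Cardinal.mk_Iio_lt a (by
    rw [mk_eq, Ordinal.type_toType, Cardinal.ord_aleph])
  rw [mk_eq] at h
  rw [← Set.countable_coe_iff, ← Cardinal.mk_le_aleph0_iff]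
  rwa [← Order.lt_succ_iff, Cardinal.succ_aleph0]

theorem countable_Iic (a : OmegaOne) : (Set.Iic a).Countable := by
  rw [← Set.Iio_insert]
  exact (countable_Iio a).insert a

theorem exists_gt_of_countable {S : Set OmegaOne} (hS : S.Countable) : ∃ b, ∀ x ∈ S, x < b := by
  by_contra! h
  have : (Set.univ : Set OmegaOne).Countable := by
    refine Set.Countable.mono (fun b _ => ?_) (hS.biUnion fun x _ => countable_Iic x)
    obtain ⟨x, hx, hb⟩ := h b
    exact Set.mem_biUnion hx hb
  rw [Set.countable_univ_iff, ← Cardinal.mk_le_aleph0_iff, mk_eq] at this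
  exact absurd this (not_le.mpr Cardinal.aleph0_lt_aleph_one)

/-- A monotone sequence of type `ω` that is cofinal below `τ`. -/
theorem exists_ladder {τ : OmegaOne} (h : (Set.Iio τ).Nonempty) :
    ∃ a : ℕ → OmegaOne, Monotone a ∧ (∀ n, a n < τ) ∧ ∀ σ < τ, ∃ n, σ ≤ a n := by
  obtain ⟨f, hf⟩ := (countable_Iio τ).exists_eq_range h
  have hlt : ∀ n, f n < τ := fun n => by
    have : f n ∈ Set.range f := ⟨n, rfl⟩
    rwa [← hf] at this
  refine ⟨partialSups f, (partialSups f).monotone, fun n => ?_, fun σ hσ => ?_⟩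
  · exact (partialSups_iff_forall (· < τ) (fun {_ _} => max_lt_iff)).mpr fun k _ => hlt k
  · have : σ ∈ Set.range f := hf ▸ hσ
    obtain ⟨n, rfl⟩ := this
    exact ⟨n, le_partialSups f n⟩

/-- A point closed under `F`, together with a cofinal sequence witnessing this. -/
theorem exists_closed_point (F : OmegaOne → OmegaOne) (α : OmegaOne) :
    ∃ (δ : OmegaOne) (a : ℕ → OmegaOne), a 0 = α ∧ StrictMono a ∧ (∀ n, a n < δ) ∧
      (∀ σ < δ, ∃ n, σ ≤ a n) ∧ ∀ n, ∀ σ ≤ a n, F σ < a (n + 1) := by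
  have step : ∀ x : OmegaOne, ∃ y, x < y ∧ ∀ σ ≤ x, F σ < y := fun x => by
    obtain ⟨b, hb⟩ := exists_gt_of_countable (((countable_Iic x).image F).insert x)
    exact ⟨b, hb x (Set.mem_insert _ _), fun σ hσ => hb _ (Or.inr ⟨σ, hσ, rfl⟩)⟩
  choose g hg hF using step
  let a : ℕ → OmegaOne := fun n => g^[n] α
  have ha : ∀ n, a (n + 1) = g (a n) := fun n => Function.iterate_succ_apply' g n α
  have hne : {b | ∀ n, a n < b}.Nonempty := by
    obtain ⟨b, hb⟩ := exists_gt_of_countable (Set.countable_range a)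
    exact ⟨b, fun n => hb _ ⟨n, rfl⟩⟩
  refine ⟨wellFounded_lt.min _ hne, a, rfl, strictMono_nat_of_lt_succ fun n => ha n ▸ hg _,
    wellFounded_lt.min_mem _ hne, fun σ hσ => ?_, fun n σ hσ => ha n ▸ hF _ σ hσ⟩
  by_contra! h
  exact wellFounded_lt.not_lt_min {b | ∀ n, a n < b} h hσ

end OmegaOne

/-! ### Coherent systems of units along `ω₁` -/

section UnitSystem

variable {R : Type u} [CommRing R]

/-- The units `e κ ρ`, for `ρ ≤ κ` in the set `S`, are coherent with respect to the ideals `I`. -/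
structure IsCoherentOn (I : OmegaOne → Ideal R) (S : Set OmegaOne)
    (e : OmegaOne → OmegaOne → Rˣ) : Prop where
  self : ∀ κ ∈ S, e κ κ = 1
  comp : ∀ σ ρ κ, σ ≤ ρ → ρ ≤ κ → κ ∈ S → (e κ ρ * e ρ σ - e κ σ : R) ∈ I σ

/-- A branch below `τ` through the tree of units modulo `I σ` given by the system `e`. -/
def IsBranchBelow (I : OmegaOne → Ideal R) (e : OmegaOne → OmegaOne → Rˣ) (τ : OmegaOne)
    (x : OmegaOne → Rˣ) : Prop :=
  ∀ σ ρ, σ ≤ ρ → ρ < τ → (x ρ * e ρ σ - x σ : R) ∈ I σ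

/-- A cofinal branch through the tree of units modulo `I σ` given by the system `e`. -/
def IsCofinalBranch (I : OmegaOne → Ideal R) (e : OmegaOne → OmegaOne → Rˣ)
    (c : OmegaOne → Rˣ) : Prop :=
  ∀ σ ρ, σ ≤ ρ → (c ρ * e ρ σ - c σ : R) ∈ I σ

/-- A family of elements, indexed by the ordinals below `τ`, which is Cauchy with respect to `I`. -/
def IsCauchyBelow (I : OmegaOne → Ideal R) (τ : OmegaOne) (y : OmegaOne → R) : Prop :=
  ∀ σ ρ, σ ≤ ρ → ρ < τ → y ρ - y σ ∈ I σ

variable {I : OmegaOne → Ideal R}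

/-- This is the freedom available at each step of the recursion: both constructions multiply an
arbitrary branch by a Cauchy family. -/
theorem IsBranchBelow.mul {e : OmegaOne → OmegaOne → Rˣ} {τ : OmegaOne} {x y : OmegaOne → Rˣ}
    (hx : IsBranchBelow I e τ x) (hy : IsCauchyBelow I τ fun σ => (y σ : R)) :
    IsBranchBelow I e τ (x * y) := by
  intro σ ρ h h'
  have h1 := (I σ).mul_mem_left (y ρ : R) (hx σ ρ h h')
  have h2 := (I σ).mul_mem_left (x σ : R) (hy σ ρ h h')
  have := (I σ).add_mem h1 h2
  simp only [Pi.mul_apply, Units.val_mul]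
  convert this using 1
  ring

theorem IsBranchBelow.congr {e e' : OmegaOne → OmegaOne → Rˣ} {τ : OmegaOne} {x : OmegaOne → Rˣ}
    (hx : IsBranchBelow I e τ x) (h : ∀ ρ < τ, e ρ = e' ρ) : IsBranchBelow I e' τ x := by
  intro σ ρ h1 h2
  rw [← h ρ h2]
  exact hx σ ρ h1 h2

theorem IsCoherentOn.congr {e e' : OmegaOne → OmegaOne → Rˣ} {τ : OmegaOne}
    (he : IsCoherentOn I (Set.Iio τ) e) (h : ∀ ρ < τ, e ρ = e' ρ) :
    IsCoherentOn I (Set.Iio τ) e' where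
  self κ hκ := by rw [← h κ hκ]; exact he.self κ hκ
  comp σ ρ κ h1 h2 h3 := by
    rw [← h κ h3, ← h ρ (h2.trans_lt h3)]
    exact he.comp σ ρ κ h1 h2 h3

/-- Below every countable ordinal a coherent system has a branch. -/
theorem IsCoherentOn.exists_branch {e : OmegaOne → OmegaOne → Rˣ}
    {τ : OmegaOne} (he : IsCoherentOn I (Set.Iio τ) e) : ∃ x, IsBranchBelow I e τ x := by
  by_cases hne : (Set.Iio τ).Nonempty
  swap
  · exact ⟨1, fun σ ρ _ h => absurd ⟨ρ, h⟩ hne⟩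
  obtain ⟨a, ha, hlt, hcof⟩ := OmegaOne.exists_ladder hne
  -- The equations can be solved upwards along the ladder because the entries of `e` are units.
  -- Modulo `I σ`, the value `f n * e (a n) σ` then does not depend on `n` as long as `σ ≤ a n`.
  obtain ⟨f, hf⟩ : ∃ f : ℕ → Rˣ, ∀ n, f (n + 1) * e (a (n + 1)) (a n) = f n :=
    ⟨fun n => Nat.rec 1 (fun n z => z * (e (a (n + 1)) (a n))⁻¹) n,
      fun n => inv_mul_cancel_right _ _⟩
  have hf' : ∀ n, (f (n + 1) : R) * e (a (n + 1)) (a n) = ((f n : Rˣ) : R) := fun n => by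
    rw [← hf n, Units.val_mul]
  have hstep : ∀ n m, n ≤ m → ∀ σ ≤ a n,
      (f m * e (a m) σ - f n * e (a n) σ : R) ∈ I σ := by
    intro n m hnm σ hσ
    induction m, hnm using Nat.le_induction with
    | base => simp
    | succ m hm ih =>
      have h1 := (I σ).mul_mem_left (f (m + 1) : R)
        (he.comp σ (a m) (a (m + 1)) (hσ.trans (ha hm)) (ha m.le_succ) (hlt _))
      have h2 := (I σ).sub_mem ih h1
      convert h2 using 1
      rw [← hf' m]
      ring
  choose k hk using fun σ : Set.Iio τ => hcof σ σ.2
  classical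
  refine ⟨fun σ => if h : σ < τ then f (k ⟨σ, h⟩) * e (a (k ⟨σ, h⟩)) σ else 1, ?_⟩
  intro σ ρ hσρ hρ
  have hσ := hσρ.trans_lt hρ
  simp only [hρ, hσ, dif_pos, Units.val_mul]
  set n := k ⟨ρ, hρ⟩ with hn
  set m := k ⟨σ, hσ⟩ with hm
  have hρn : ρ ≤ a n := hk ⟨ρ, hρ⟩
  have hσm : σ ≤ a m := hk ⟨σ, hσ⟩
  have key : (f n * e (a n) σ - f m * e (a m) σ : R) ∈ I σ := by
    rcases le_total m n with h | h
    · exact hstep m n h σ hσm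
    · have := hstep n m h σ (hσρ.trans hρn)
      rw [← neg_mem_iff, neg_sub]
      exact this
  have h1 := (I σ).mul_mem_left (f n : R) (he.comp σ ρ (a n) hσρ hρn (hlt n))
  have := (I σ).add_mem h1 key
  convert this using 1
  ring

open Classical in
/-- The system of units obtained by recursion: `sel τ` chooses the units `e τ σ`, `σ < τ`, from the
system below `τ`. -/
noncomputable def recSystem
    (sel : OmegaOne → (OmegaOne → OmegaOne → Rˣ) → OmegaOne → Rˣ) : OmegaOne → OmegaOne → Rˣ :=
  wellFounded_lt.fix fun τ e σ =>
    if σ < τ then sel τ (fun ρ => if h : ρ < τ then e ρ h else 1) σ else 1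

open Classical in
/-- The part of a system below `τ`, extended trivially. -/
noncomputable def truncBelow (τ : OmegaOne) (e : OmegaOne → OmegaOne → Rˣ) :
    OmegaOne → OmegaOne → Rˣ :=
  fun ρ => if ρ < τ then e ρ else 1

theorem truncBelow_apply {τ ρ : OmegaOne} (e : OmegaOne → OmegaOne → Rˣ) (h : ρ < τ) :
    truncBelow τ e ρ = e ρ := if_pos h

variable (sel : OmegaOne → (OmegaOne → OmegaOne → Rˣ) → OmegaOne → Rˣ)

open Classical in
theorem recSystem_eq (τ : OmegaOne) :
    recSystem sel τ =
      fun σ => if σ < τ then sel τ (truncBelow τ (recSystem sel)) σ else 1 := by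
  rw [recSystem, WellFounded.fix_eq]
  rfl

theorem recSystem_of_lt {σ τ : OmegaOne} (h : σ < τ) :
    recSystem sel τ σ = sel τ (truncBelow τ (recSystem sel)) σ := by
  rw [recSystem_eq]
  exact if_pos h

theorem recSystem_self (τ : OmegaOne) : recSystem sel τ τ = 1 := by
  rw [recSystem_eq]
  exact if_neg (lt_irrefl τ)

/-- The recursion is local. This allows the systems of two functions η, η' that agree below δ to be
compared at δ. -/
theorem recSystem_congr {sel' : OmegaOne → (OmegaOne → OmegaOne → Rˣ) → OmegaOne → Rˣ}
    {τ : OmegaOne} (h : ∀ ρ < τ, sel ρ = sel' ρ) : ∀ ρ < τ, recSystem sel ρ = recSystem sel' ρ := by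
  intro ρ
  induction ρ using WellFoundedLT.induction with
  | _ ρ ih =>
    intro hρ
    have : truncBelow ρ (recSystem sel) = truncBelow ρ (recSystem sel') := by
      funext κ
      by_cases hκ : κ < ρ
      · rw [truncBelow_apply _ hκ, truncBelow_apply _ hκ, ih κ hκ (hκ.trans hρ)]
      · simp only [truncBelow, if_neg hκ]
    rw [recSystem_eq sel, recSystem_eq sel', this, h ρ hρ]

/-- Coherence with top index κ says that row κ is a branch below κ. Induction is needed since `sel`
is controlled only on systems already known to be coherent. -/
theorem recSystem_coherentBelow
    (hsel : ∀ τ e, IsCoherentOn I (Set.Iio τ) e → IsBranchBelow I e τ (sel τ e)) (τ : OmegaOne) :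
    IsCoherentOn I (Set.Iio τ) (recSystem sel) := by
  induction τ using WellFoundedLT.induction with
  | _ τ ih =>
    refine ⟨fun κ _ => recSystem_self sel κ, fun σ ρ κ h1 h2 h3 => ?_⟩
    have hcoh := ih κ h3
    have hbr := (hsel κ _ (hcoh.congr fun ρ h => (truncBelow_apply _ h).symm)).congr
      fun ρ h => truncBelow_apply _ h
    rcases h2.eq_or_lt with rfl | h2
    · simp [recSystem_self]
    · have := hbr σ ρ h1 h2
      rwa [← recSystem_of_lt sel h2, ← recSystem_of_lt sel (h1.trans_lt h2)] at this

theorem recSystem_coherent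
    (hsel : ∀ τ e, IsCoherentOn I (Set.Iio τ) e → IsBranchBelow I e τ (sel τ e)) :
    IsCoherentOn I Set.univ (recSystem sel) := by
  refine ⟨fun κ _ => recSystem_self sel κ, fun σ ρ κ h1 h2 _ => ?_⟩
  obtain ⟨τ, hτ⟩ := OmegaOne.exists_gt_of_countable (Set.countable_singleton κ)
  exact (recSystem_coherentBelow sel hsel τ).comp σ ρ κ h1 h2 (hτ κ rfl)

end UnitSystem

/-! ### Systems without cofinal branches: rings of cardinality less than the continuum -/

section Avoiding

variable {R : Type u} [CommRing R] {I : OmegaOne → Ideal R}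

theorem isUnit_of_sub_mem [IsLocalRing R] {K : Ideal R} (hK : K ≠ ⊤) {x y : R} (hx : IsUnit x)
    (h : y - x ∈ K) : IsUnit y := by
  by_contra hy
  have h1 := IsLocalRing.le_maximalIdeal hK h
  have h2 : y ∈ IsLocalRing.maximalIdeal R := (IsLocalRing.mem_maximalIdeal y).mpr hy
  have h3 := (IsLocalRing.maximalIdeal R).sub_mem h2 h1
  rw [sub_sub_cancel] at h3
  exact (IsLocalRing.mem_maximalIdeal x).mp h3 hx

/-- Increments `α n ∈ I (a n)` and the countable sets `P n` of partial sums, the former chosen so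
that ratios of the latter avoid the countable set `N`. -/
theorem exists_avoiding_increments {a : ℕ → OmegaOne}
    (hunc : ∀ n, ∀ S : Set R, S.Countable → ∃ x ∈ I (a n), ∀ s ∈ S, x - s ∉ I (a (n + 1)))
    {N : Set R} (hN : N.Countable) :
    ∃ (P : ℕ → Set R) (α : ℕ → R), 1 ∈ P 0 ∧ (∀ n, ∀ p ∈ P n, p ∈ P (n + 1) ∧ p + α n ∈ P (n + 1)) ∧
      (∀ n, α n ∈ I (a n)) ∧
      ∀ n, ∀ m ∈ N, ∀ m' ∈ N, ∀ p ∈ P n, α n - Ring.inverse m * (m' - m) * p ∉ I (a (n + 1)) := by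
  -- The excluded values solve `m ≡ u * p` and `m' ≡ u * (p + x)` for `x`, with the unknown unit `u`
  -- eliminated. `Ring.inverse` avoids demanding that members of `N` be units; the `m` that matters
  -- later is one.
  have step : ∀ (n : ℕ) (P : {S : Set R // S.Countable}), ∃ x ∈ I (a n),
      ∀ m ∈ N, ∀ m' ∈ N, ∀ p ∈ P.1, x - Ring.inverse m * (m' - m) * p ∉ I (a (n + 1)) := by
    intro n P
    obtain ⟨x, hx, h⟩ := hunc n
      ((fun t : R × R × R => Ring.inverse t.1 * (t.2.1 - t.1) * t.2.2) '' (N ×ˢ N ×ˢ P.1))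
      ((hN.prod (hN.prod P.2)).image _)
    exact ⟨x, hx, fun m hm m' hm' p hp => h _ ⟨(m, m', p), ⟨hm, hm', hp⟩, rfl⟩⟩
  choose α hα hα' using step
  let P : ℕ → {S : Set R // S.Countable} := fun n => Nat.rec ⟨{1}, Set.countable_singleton 1⟩
    (fun n S => ⟨S.1 ∪ (fun p => p + α n S) '' S.1, S.2.union (S.2.image _)⟩) n
  exact ⟨fun n => (P n).1, fun n => α n (P n), rfl,
    fun n p hp => ⟨Or.inl hp, Or.inr ⟨p, hp, rfl⟩⟩, fun n => hα n _, fun n => hα' n _⟩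

/-- Below `δ` there is a Cauchy family of units such that no unit multiple of its product with `x`
takes values in the countable set `N` modulo the ideals `I σ`. -/
theorem exists_cauchy_avoiding [IsLocalRing R] (hI : Antitone I)
    (hR : Cardinal.mk R < Cardinal.continuum) {δ : OmegaOne} {a : ℕ → OmegaOne} (ha : StrictMono a)
    (hlt : ∀ n, a n < δ) (hcof : ∀ σ < δ, ∃ n, σ ≤ a n) (htop : I (a 0) ≠ ⊤)
    (hunc : ∀ n, ∀ S : Set R, S.Countable → ∃ x ∈ I (a n), ∀ s ∈ S, x - s ∉ I (a (n + 1)))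
    {N : Set R} (hN : N.Countable) (x : OmegaOne → Rˣ) :
    ∃ y : OmegaOne → Rˣ, IsCauchyBelow I δ (fun σ => (y σ : R)) ∧
      ∀ d : Rˣ, ∃ σ < δ, ∀ m ∈ N, m - (d * (x * y) σ : Rˣ) ∉ I σ := by
  obtain ⟨P, α, hP0, hP, hα, hav⟩ := exists_avoiding_increments hunc hN
  -- Each `ε` selects a subset of the increments, which gives continuum many Cauchy sequences. They
  -- consist of units since they start at 1 and `I (a 0)` is proper.
  let p : (ℕ → Bool) → ℕ → R := fun ε n =>
    Nat.rec 1 (fun n z => z + if ε n then α n else 0) n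
  have hps : ∀ ε n, p ε (n + 1) = p ε n + if ε n then α n else 0 := fun _ _ => rfl
  have hpP : ∀ ε n, p ε n ∈ P n := by
    intro ε n
    induction n with
    | zero => exact hP0
    | succ n ih =>
      rw [hps]
      split_ifs
      · exact (hP n _ ih).2
      · rw [add_zero]
        exact (hP n _ ih).1
  have hpc : ∀ ε n m, n ≤ m → p ε m - p ε n ∈ I (a n) := by
    intro ε n m h
    induction m, h using Nat.le_induction with
    | base => simp
    | succ m hm ih =>
      rw [hps, add_sub_right_comm]
      refine (I (a n)).add_mem ih ?_
      split_ifs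
      · exact hI (ha.monotone hm) (hα m)
      · exact zero_mem _
  have hpu : ∀ ε n, IsUnit (p ε n) := fun ε n =>
    isUnit_of_sub_mem htop isUnit_one (hpc ε 0 n n.zero_le)
  choose k hk using fun σ : Set.Iio δ => hcof σ σ.2
  classical
  let y : (ℕ → Bool) → OmegaOne → Rˣ := fun ε σ =>
    if h : σ < δ then (hpu ε (k ⟨σ, h⟩)).unit else 1
  have hy : ∀ ε σ (h : σ < δ), (y ε σ : R) = p ε (k ⟨σ, h⟩) := fun ε σ h => by
    simp only [y, dif_pos h, IsUnit.unit_spec]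
  have hyc : ∀ ε, IsCauchyBelow I δ fun σ => (y ε σ : R) := by
    intro ε σ ρ hσρ hρ
    have hσ := hσρ.trans_lt hρ
    simp only [hy ε σ hσ, hy ε ρ hρ]
    rcases le_total (k ⟨σ, hσ⟩) (k ⟨ρ, hρ⟩) with h | h
    · exact hI (hk ⟨σ, hσ⟩) (hpc ε _ _ h)
    · have := hI (hσρ.trans (hk ⟨ρ, hρ⟩)) (hpc ε _ _ h)
      rwa [← neg_mem_iff, neg_sub]
  by_contra! hcon
  choose d hd using fun ε => hcon (y ε) (hyc ε)
  -- If every path fails through some unit `d ε`, two paths share this unit, because `R` has fewer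
  -- than continuum many elements.
  have hninj : ¬ Function.Injective d := by
    intro hinj
    have h2 := Cardinal.lift_mk_le_lift_mk_of_injective (f := fun ε => (d ε : R))
      (fun ε ε' h => hinj (Units.ext h))
    have h3 : Cardinal.lift.{u} (Cardinal.mk (ℕ → Bool)) = Cardinal.continuum.{u} := by simp
    rw [h3, Cardinal.lift_uzero] at h2
    exact absurd h2 (not_le.mpr hR)
  -- At the first splitting the partial sums are `q` and `q + α n`. With a common `d`, both being
  -- met by `N` forces `α n` into a class that was avoided.
  have hkey : ∀ ε ε', d ε = d ε' → ∀ n, (∀ i < n, ε i = ε' i) → ε n = false → ε' n = true →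
      False := by
    intro ε ε' hdd n hn h0 h1
    have hpn : p ε' n = p ε n := by
      have : ∀ i ≤ n, p ε' i = p ε i := by
        intro i hi
        induction i with
        | zero => rfl
        | succ i ih => rw [hps, hps, ih (by lia), hn i (by lia)]
      exact this n le_rfl
    have hσ := hlt (n + 1)
    obtain ⟨m, hm, hmI⟩ := hd ε _ hσ
    obtain ⟨m', hm', hmI'⟩ := hd ε' _ hσ
    have hle : n + 1 ≤ k ⟨_, hσ⟩ := ha.le_iff_le.mp (hk ⟨_, hσ⟩)
    have hc := hpc ε _ _ hle
    have hc' := hpc ε' _ _ hle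
    rw [← hdd] at hmI'
    simp only [Pi.mul_apply, Units.val_mul, hy _ _ hσ] at hmI hmI'
    rw [hps, h0] at hc
    rw [hps, h1, hpn] at hc'
    simp only [Bool.false_eq_true, if_false, if_true, add_zero] at hc hc'
    set q := p ε n
    set u : R := (d ε : R) * x (a (n + 1)) with hu
    have e1 : m - u * q ∈ I (a (n + 1)) := by
      have := (I (a (n + 1))).add_mem hmI ((I (a (n + 1))).mul_mem_left u hc)
      convert this using 1
      rw [hu]
      ring
    have e2 : m' - u * (q + α n) ∈ I (a (n + 1)) := by
      have := (I (a (n + 1))).add_mem hmI' ((I (a (n + 1))).mul_mem_left u hc')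
      convert this using 1
      rw [hu]
      ring
    have htop' : I (a (n + 1)) ≠ ⊤ := fun h => htop
      (top_le_iff.mp (h ▸ hI (ha.monotone (n + 1).zero_le)))
    have hmu : IsUnit m := isUnit_of_sub_mem htop'
      (((d ε).isUnit.mul (x (a (n + 1))).isUnit).mul (hpu ε n)) e1
    refine hav n m hm m' hm' q (hpP ε n) ?_
    have e3 := (I (a (n + 1))).mul_mem_left (Ring.inverse m) ((I (a (n + 1))).sub_mem
      ((I (a (n + 1))).mul_mem_right (q + α n) e1) ((I (a (n + 1))).mul_mem_right q e2))
    convert e3 using 1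
    have := Ring.inverse_mul_cancel m hmu
    linear_combination (-α n) * this
  rw [Function.Injective] at hninj
  push Not at hninj
  obtain ⟨ε, ε', hdd, hne⟩ := hninj
  have hex : ∃ n, ε n ≠ ε' n := Function.ne_iff.mp hne
  have hmin : ∀ i < Nat.find hex, ε i = ε' i := fun i hi => not_not.mp (Nat.find_min hex hi)
  have hspec := Nat.find_spec hex
  cases h : ε (Nat.find hex) with
  | false =>
    refine hkey ε ε' hdd _ hmin h ?_
    rw [h] at hspec
    simpa using hspec.symm
  | true =>
    refine hkey ε' ε hdd.symm _ (fun i hi => (hmin i hi).symm) ?_ h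
    rw [h] at hspec
    simpa using hspec.symm

/-- If `R` has cardinality less than the continuum, is covered by a sequence of length `ω₁`, and the
quotients `I ν / I μ` are uncountable, there is a coherent system without cofinal branch. -/
theorem exists_coherent_of_lt_continuum [IsLocalRing R] (hI : Antitone I)
    (hR : Cardinal.mk R < Cardinal.continuum) {g : OmegaOne → R} (hg : Function.Surjective g)
    {ν₀ : OmegaOne} (htop : I ν₀ ≠ ⊤)
    (hunc : ∀ ν, ν₀ ≤ ν → ∃ μ, ∀ S : Set R, S.Countable → ∃ x ∈ I ν, ∀ s ∈ S, x - s ∉ I μ) :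
    ∃ e : OmegaOne → OmegaOne → Rˣ, IsCoherentOn I Set.univ e ∧ ∀ c, ¬ IsCofinalBranch I e c := by
  classical
  -- The avoidance is required only where some branch achieves it, so that a choice exists at every
  -- `τ`. It will be achievable at the closure point used below.
  let Good : OmegaOne → (OmegaOne → OmegaOne → Rˣ) → (OmegaOne → Rˣ) → Prop := fun τ e x =>
    IsBranchBelow I e τ x ∧ ((∃ z, IsBranchBelow I e τ z ∧
      ∀ d : Rˣ, ∃ σ < τ, ∀ m ∈ g '' Set.Iio τ, m - (d * z σ : Rˣ) ∉ I σ) →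
      ∀ d : Rˣ, ∃ σ < τ, ∀ m ∈ g '' Set.Iio τ, m - (d * x σ : Rˣ) ∉ I σ)
  have hGood : ∀ τ e, IsCoherentOn I (Set.Iio τ) e → ∃ x, Good τ e x := by
    intro τ e he
    by_cases h : ∃ z, IsBranchBelow I e τ z ∧
      ∀ d : Rˣ, ∃ σ < τ, ∀ m ∈ g '' Set.Iio τ, m - (d * z σ : Rˣ) ∉ I σ
    · obtain ⟨z, hz, hz'⟩ := h
      exact ⟨z, hz, fun _ => hz'⟩
    · obtain ⟨z, hz⟩ := he.exists_branch
      exact ⟨z, hz, fun h' => absurd h' h⟩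
  let sel : OmegaOne → (OmegaOne → OmegaOne → Rˣ) → OmegaOne → Rˣ := fun τ e =>
    if h : ∃ x, Good τ e x then h.choose else 1
  have hsel : ∀ τ e, IsCoherentOn I (Set.Iio τ) e → Good τ e (sel τ e) := by
    intro τ e he
    simp only [sel, dif_pos (hGood τ e he)]
    exact (hGood τ e he).choose_spec
  have hcoh := recSystem_coherent sel fun τ e he => (hsel τ e he).1
  refine ⟨recSystem sel, hcoh, fun c hc => ?_⟩
  choose! f hf using hunc
  -- Closure under `f` makes the successive quotients along `a` uncountable; closure under the
  -- indices of the values of `c` puts `c σ`, for `σ < δ`, into `g '' Set.Iio δ`.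
  obtain ⟨δ, a, ha0, ha, hlt, hcof, hF⟩ := OmegaOne.exists_closed_point
    (fun ν => max (f ν) (Function.surjInv hg (c ν))) ν₀
  have hδ : IsCoherentOn I (Set.Iio δ) (truncBelow δ (recSystem sel)) :=
    (IsCoherentOn.congr ⟨fun κ _ => hcoh.self κ trivial,
      fun σ ρ κ h1 h2 _ => hcoh.comp σ ρ κ h1 h2 trivial⟩
      fun ρ h => (truncBelow_apply _ h).symm)
  -- With `d = c δ`, the avoidance contradicts `c δ * e δ σ ≡ c σ`.
  have hspecial := (hsel δ _ hδ).2 ?_ (c δ)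
  · obtain ⟨σ, hσ, h⟩ := hspecial
    refine h (c σ) ⟨Function.surjInv hg (c σ), ?_, Function.surjInv_eq hg _⟩ ?_
    · obtain ⟨n, hn⟩ := hcof σ hσ
      exact (((le_max_right _ _).trans_lt (hF n σ hn))).trans (hlt _)
    · have := hc σ δ hσ.le
      rw [recSystem_of_lt sel hσ] at this
      rw [← neg_mem_iff, neg_sub, Units.val_mul]
      exact this
  · obtain ⟨x, hx⟩ := hδ.exists_branch
    have hun : ∀ n, ∀ S : Set R, S.Countable →
        ∃ x ∈ I (a n), ∀ s ∈ S, x - s ∉ I (a (n + 1)) := by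
      intro n S hS
      have hn : ν₀ ≤ a n := ha0 ▸ ha.monotone n.zero_le
      obtain ⟨z, hz, h⟩ := hf _ hn S hS
      exact ⟨z, hz, fun s hs h' => h s hs (hI ((le_max_left _ _).trans (hF n _ le_rfl).le) h')⟩
    obtain ⟨y, hy, hav⟩ := exists_cauchy_avoiding hI hR ha hlt hcof (ha0 ▸ htop) hun
      ((OmegaOne.countable_Iio δ).image g) x
    exact ⟨x * y, hx.mul hy, hav⟩

end Avoiding

/-! ### Systems without cofinal branches: under the continuum hypothesis -/

section WeakDiamond

theorem exists_injective_code (T : Type*) [Countable T] :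
    ∃ f : (T → ℕ → Bool) → ℕ → Bool, Function.Injective f := by
  obtain ⟨i, hi⟩ := Countable.exists_injective_nat (T × ℕ)
  refine ⟨fun f => Function.extend i (Function.uncurry f) fun _ => false, fun f f' h => ?_⟩
  funext t n
  have := congrFun h (i (t, n))
  simpa only [hi.extend_apply, Function.uncurry_apply_pair] using this

/-- Already the functions ω₁ → 2 number 2^ℵ₁ > ℵ₁ ≥ 2^ℵ₀. This is the only use of the continuum
hypothesis in the weak diamond. -/
theorem not_injective_of_continuum_le
    (hCH : Cardinal.continuum.{0} ≤ Cardinal.aleph 1)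
    (f : (OmegaOne → ℕ → Bool) → ℕ → Bool) : ¬ Function.Injective f := by
  intro hf
  have h1 : Function.Injective fun η : OmegaOne → Bool => f fun σ _ => η σ := by
    intro η η' h
    funext σ
    exact congrFun (congrFun (hf h) σ) 0
  have h2 := Cardinal.mk_le_of_injective h1
  have h3 : Cardinal.mk (OmegaOne → Bool) = 2 ^ Cardinal.aleph 1 := by
    simp
  have h4 : Cardinal.mk (ℕ → Bool) = Cardinal.continuum := by simp
  rw [h3, h4] at h2
  exact absurd (h2.trans hCH) (not_le.mpr (Cardinal.cantor _))

/-- Under the continuum hypothesis, a prediction of `η δ` for all `δ` in a club, from the part below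
`δ` of `η` and of an auxiliary function `c η`, fails for some `η` (this is the weak diamond
principle). -/
theorem exists_agree_below_of_continuum_le (hCH : Cardinal.continuum.{0} ≤ Cardinal.aleph 1)
    {C : Set OmegaOne} (hC : IsClub C) (c : (OmegaOne → Bool) → OmegaOne → ℕ → Bool) :
    ∃ η η' : OmegaOne → Bool, ∃ δ ∈ C, (∀ σ < δ, η σ = η' σ) ∧ (∀ σ < δ, c η σ = c η' σ) ∧
      η δ ≠ η' δ := by
  by_contra! hcon
  obtain ⟨code, hcode⟩ := exists_injective_code ℕ
  have hinit : ∀ β : OmegaOne, ∃ f : (Set.Iio β → ℕ → Bool) → ℕ → Bool,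
      Function.Injective f := fun β =>
    have : Countable (Set.Iio β) := (OmegaOne.countable_Iio β).to_subtype
    exists_injective_code _
  choose init hinit using hinit
  have hnext : ∀ ρ : OmegaOne, {β | β ∈ C ∧ ρ < β}.Nonempty := by
    intro ρ
    obtain ⟨b, hb⟩ := OmegaOne.exists_gt_of_countable (Set.countable_singleton ρ)
    obtain ⟨β, hβ, hle⟩ := hC.isCofinal b
    exact ⟨β, hβ, (hb ρ rfl).trans_le hle⟩
  let next : OmegaOne → OmegaOne := fun ρ => wellFounded_lt.min _ (hnext ρ)
  have hnext_gt : ∀ ρ, ρ < next ρ := fun ρ => (wellFounded_lt.min_mem _ (hnext ρ)).2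
  have hnext_le : ∀ ρ β, β ∈ C → ρ < β → next ρ ≤ β := fun ρ β h h' =>
    not_lt.mp (wellFounded_lt.not_lt_min {β | β ∈ C ∧ ρ < β} ⟨h, h'⟩)
  -- `Φ` applies `c` to countably many functions at once. `L` stores at `ρ` all of `h` below the
  -- next point of `C`, so one predicted value at `δ ∈ C` recovers `h` up to `next δ`.
  let Φ : (OmegaOne → ℕ → Bool) → OmegaOne → ℕ → Bool := fun h σ =>
    code fun n => c (fun τ => h τ n) σ
  let L : (OmegaOne → ℕ → Bool) → OmegaOne → ℕ → Bool := fun h ρ =>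
    init (next ρ) fun σ => h σ
  have hΦ : ∀ h h' : OmegaOne → ℕ → Bool, ∀ δ ∈ C, (∀ σ < δ, h σ = h' σ) →
      (∀ σ < δ, Φ h σ = Φ h' σ) → h δ = h' δ := by
    intro h h' δ hδ h1 h2
    funext n
    exact hcon _ _ δ hδ (fun σ hσ => congrFun (h1 σ hσ) n)
      fun σ hσ => congrFun (hcode (h2 σ hσ)) n
  have hL : ∀ h h' : OmegaOne → ℕ → Bool, ∀ ρ, L h ρ = L h' ρ ↔ ∀ σ < next ρ, h σ = h' σ := by
    intro h h' ρ
    constructor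
    · intro heq σ hσ
      exact congrFun (hinit _ heq) ⟨σ, hσ⟩
    · intro heq
      exact congrArg (init (next ρ)) (funext fun σ => heq σ.1 σ.2)
  let H : (OmegaOne → ℕ → Bool) → ℕ → OmegaOne → ℕ → Bool := fun h k => (fun h => Φ (L h))^[k] h
  have hH : ∀ h k, H h (k + 1) = Φ (L (H h k)) := fun h k => Function.iterate_succ_apply' _ k h
  obtain ⟨δ₀, hδ₀, -⟩ := hC.isCofinal (Classical.arbitrary OmegaOne)
  have hdet : ∀ h h', (∀ k, ∀ σ < δ₀, H h k σ = H h' k σ) → ∀ β k, H h k β = H h' k β := by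
    intro h h' h0 β
    induction β using WellFoundedLT.induction with
    | _ β ih =>
      intro k
      rcases lt_or_ge β δ₀ with hβ | hβ
      · exact h0 k β hβ
      -- This is the last point of `C` up to `β`, so that `δ ≤ β < next δ`.
      · obtain ⟨δ, hlub⟩ : ∃ δ, IsLUB (C ∩ Set.Iic β) δ := by
          have hne : (upperBounds (C ∩ Set.Iic β)).Nonempty := ⟨β, fun x hx => hx.2⟩
          exact ⟨wellFounded_lt.min _ hne, wellFounded_lt.min_mem _ hne, fun x hx =>
            not_lt.mp (wellFounded_lt.not_lt_min _ hx)⟩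
        have hδ : δ ∈ C := hC.isLUB_mem Set.inter_subset_left ⟨δ₀, hδ₀, hβ⟩ hlub
        have hδβ : δ ≤ β := hlub.2 fun x hx => hx.2
        have hlt : β < next δ := by
          by_contra! hle
          exact (hnext_gt δ).not_ge (hlub.1 ⟨(wellFounded_lt.min_mem _ (hnext δ)).1, hle⟩)
        refine (hL _ _ δ).mp (hΦ _ _ δ hδ (fun ρ hρ => ?_) fun ρ hρ => ?_) β hlt
        · exact (hL _ _ ρ).mpr fun σ hσ =>
            ih σ ((hσ.trans_le (hnext_le ρ δ hδ hρ)).trans_le hδβ) k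
        · rw [← hH, ← hH]
          exact ih ρ (hρ.trans_le hδβ) (k + 1)
  have : Countable (Set.Iio δ₀) := (OmegaOne.countable_Iio δ₀).to_subtype
  obtain ⟨f, hf⟩ := exists_injective_code (ℕ × Set.Iio δ₀)
  refine not_injective_of_continuum_le hCH (fun h => f fun t => H h t.1 t.2) fun h h' heq => ?_
  funext β
  exact hdet h h' (fun k σ hσ => congrFun (hf heq) (k, ⟨σ, hσ⟩)) β 0

variable {R : Type u} [CommRing R] {I : OmegaOne → Ideal R}

/-- A Cauchy family without limit can be replaced by one that consists of units. -/
theorem IsCauchyBelow.exists_units [IsLocalRing R] (hI : Antitone I) {δ : OmegaOne}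
    {ξ : OmegaOne → R} (hξ : IsCauchyBelow I δ ξ) (hlim : ∀ z, ∃ σ < δ, z - ξ σ ∉ I σ) :
    ∃ y : OmegaOne → Rˣ, IsCauchyBelow I δ (fun σ => (y σ : R)) ∧
      ∀ z : R, ∃ σ < δ, z - y σ ∉ I σ := by
  obtain ⟨σ₀, hσ₀, htop⟩ : ∃ σ₀ < δ, I σ₀ ≠ ⊤ := by
    obtain ⟨σ, hσ, h⟩ := hlim 0
    exact ⟨σ, hσ, fun h' => h (h' ▸ Submodule.mem_top)⟩
  obtain ⟨b, hb⟩ : ∃ b : R, IsUnit (b + ξ σ₀) := by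
    -- A constant shift preserves both the Cauchy property and the absence of a limit. Once the
    -- value at `σ₀` is a unit, so are all later ones, since `I σ₀` is proper; the earlier indices
    -- reuse the value at `σ₀`.
    by_cases h : IsUnit (ξ σ₀)
    · exact ⟨0, by rwa [zero_add]⟩
    · exact ⟨1 - ξ σ₀, by rw [sub_add_cancel]; exact isUnit_one⟩
  have hmax : ∀ σ < δ, max σ σ₀ < δ := fun σ hσ => max_lt hσ hσ₀
  have hu : ∀ σ < δ, IsUnit (b + ξ (max σ σ₀)) := fun σ hσ =>
    isUnit_of_sub_mem htop hb (by
      rw [add_sub_add_left_eq_sub]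
      exact hξ σ₀ _ (le_max_right _ _) (hmax σ hσ))
  classical
  have hy : ∀ σ (h : σ < δ),
      (((if h : σ < δ then (hu σ h).unit else 1) : Rˣ) : R) = b + ξ (max σ σ₀) := fun σ h => by
    rw [dif_pos h, IsUnit.unit_spec]
  refine ⟨fun σ => if h : σ < δ then (hu σ h).unit else 1, fun σ ρ h1 h2 => ?_, fun z => ?_⟩
  · simp only [hy σ (h1.trans_lt h2), hy ρ h2]
    rw [add_sub_add_left_eq_sub]
    exact hI (le_max_left σ σ₀) (hξ _ _ (max_le_max_right _ h1) (hmax ρ h2))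
  · obtain ⟨σ, hσ, h⟩ := hlim (z - b)
    refine ⟨σ, hσ, fun h' => h ?_⟩
    simp only [hy σ hσ] at h'
    have := (I σ).add_mem h' (hξ σ _ (le_max_left _ _) (hmax σ hσ))
    convert this using 1
    ring

/-- Under the continuum hypothesis, if `R` has cardinality at most `ℵ₁` and there are Cauchy families
without limit below all points of a club, there is a coherent system without cofinal branch. -/
theorem exists_coherent_of_continuum_le [IsLocalRing R] (hI : Antitone I)
    (hCH : Cardinal.continuum.{0} ≤ Cardinal.aleph 1) (hR : Cardinal.mk R ≤ Cardinal.aleph 1)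
    {C : Set OmegaOne} (hC : IsClub C)
    (hinc : ∀ δ ∈ C, ∃ ξ, IsCauchyBelow I δ ξ ∧ ∀ z, ∃ σ < δ, z - ξ σ ∉ I σ) :
    ∃ e : OmegaOne → OmegaOne → Rˣ, IsCoherentOn I Set.univ e ∧ ∀ c, ¬ IsCofinalBranch I e c := by
  classical
  have hunits : ∀ δ ∈ C, ∃ y : OmegaOne → Rˣ, IsCauchyBelow I δ (fun σ => (y σ : R)) ∧
      ∀ z : R, ∃ σ < δ, z - y σ ∉ I σ := fun δ hδ => by
    obtain ⟨ξ, hξ, hlim⟩ := hinc δ hδ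
    exact hξ.exists_units hI hlim
  choose! y hy hlim using hunits
  let base : OmegaOne → (OmegaOne → OmegaOne → Rˣ) → OmegaOne → Rˣ := fun τ e =>
    if h : ∃ x, IsBranchBelow I e τ x then h.choose else 1
  have hbase : ∀ τ e, IsCoherentOn I (Set.Iio τ) e → IsBranchBelow I e τ (base τ e) := by
    intro τ e he
    simp only [base, dif_pos he.exists_branch]
    exact he.exists_branch.choose_spec
  -- The bit `η τ` decides whether row `τ` is multiplied by the family without limit.
  let tw : Bool → OmegaOne → OmegaOne → Rˣ := fun b τ => if b = true ∧ τ ∈ C then y τ else 1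
  let sel : (OmegaOne → Bool) → OmegaOne → (OmegaOne → OmegaOne → Rˣ) → OmegaOne → Rˣ :=
    fun η τ e => base τ e * tw (η τ) τ
  have hcoh : ∀ η, IsCoherentOn I Set.univ (recSystem (sel η)) := by
    refine fun η => recSystem_coherent _ fun τ e he => (hbase τ e he).mul ?_
    by_cases h : η τ = true ∧ τ ∈ C
    · simp only [tw, if_pos h]
      exact hy τ h.2
    · simp only [tw, if_neg h]
      intro σ ρ _ _
      simp
  by_contra! hcon
  choose c hc using fun η => hcon _ (hcoh η)
  obtain ⟨j, hj⟩ : ∃ j : R → ℕ → Bool, Function.Injective j := by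
    have h1 : Cardinal.lift.{0} (Cardinal.mk R) ≤ Cardinal.lift.{u} (Cardinal.mk (ℕ → Bool)) := by
      rw [Cardinal.lift_uzero]
      refine (hR.trans Cardinal.aleph_one_le_continuum).trans (le_of_eq ?_)
      simp
    obtain ⟨j⟩ := Cardinal.lift_mk_le'.mp h1
    exact ⟨j, j.injective⟩
  obtain ⟨η, η', δ, hδ, h1, h2, h3⟩ :=
    exists_agree_below_of_continuum_le hCH hC fun η σ => j (c η σ)
  have hmain : ∀ η η' : OmegaOne → Bool, (∀ σ < δ, η σ = η' σ) → (∀ σ < δ, c η σ = c η' σ) →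
      η δ = false → η' δ = true → False := by
    intro η η' h1 h2 h3 h4
    have htr : truncBelow δ (recSystem (sel η)) = truncBelow δ (recSystem (sel η')) := by
      funext ρ
      by_cases hρ : ρ < δ
      · rw [truncBelow_apply _ hρ, truncBelow_apply _ hρ]
        refine recSystem_congr _ (fun τ hτ => ?_) ρ hρ
        simp only [sel, h1 τ hτ]
      · simp only [truncBelow, if_neg hρ]
    -- Below `δ` both systems have the same base branch `x` and `c η = c η'`, so `c η δ * x ≡ c η' δ
    -- * x * y δ`. Cancelling shows that this quotient is a limit of `y δ`.
    obtain ⟨σ, hσ, hn⟩ := hlim δ hδ (c η δ * ((c η' δ)⁻¹ : Rˣ) : R)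
    have e1 := hc η σ δ hσ.le
    have e2 := hc η' σ δ hσ.le
    rw [recSystem_of_lt _ hσ] at e1 e2
    rw [← htr, ← h2 σ hσ] at e2
    have t1 : tw (η δ) δ = 1 := if_neg fun h => by simp [h3] at h
    have t2 : tw (η' δ) δ = y δ := if_pos ⟨h4, hδ⟩
    simp only [sel, t1, t2, Pi.one_apply, mul_one, Pi.mul_apply, Units.val_mul] at e1 e2
    set x := base δ (truncBelow δ (recSystem (sel η))) σ
    refine hn ?_
    have e3 := (I σ).mul_mem_left (((c η' δ)⁻¹ : Rˣ) * (x⁻¹ : Rˣ) : R) ((I σ).sub_mem e1 e2)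
    convert e3 using 1
    have u1 : (((c η' δ)⁻¹ : Rˣ) : R) * (c η' δ : Rˣ) = 1 := Units.inv_mul _
    have u2 : ((x⁻¹ : Rˣ) : R) * (x : Rˣ) = 1 := Units.inv_mul _
    linear_combination (-(c η δ : R) * ((c η' δ)⁻¹ : Rˣ)) * u2 + (y δ σ : R) * u1 +
      (y δ σ * ((c η' δ)⁻¹ : Rˣ) * (c η' δ : Rˣ) : R) * u2
  have h2' : ∀ σ < δ, c η σ = c η' σ := fun σ hσ => Units.ext (hj (h2 σ hσ))
  cases h : η δ with
  | false =>
    rw [h] at h3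
    exact hmain η η' h1 h2' h (by simpa using h3.symm)
  | true =>
    rw [h] at h3
    exact hmain η' η (fun σ hσ => (h1 σ hσ).symm) (fun σ hσ => (h2' σ hσ).symm)
      (by simpa using h3.symm) h

end WeakDiamond

/-! ### The uniserial module given by a coherent system -/

section LimitModule

variable {R : Type u} [CommRing R] {I : OmegaOne → Ideal R} {e : OmegaOne → OmegaOne → Rˣ}

/-- The direct limit of the cyclic modules `R ⧸ I σ`, with the transition maps given by the elements
`s σ ρ * e ρ σ`. -/
theorem IsCoherentOn.exists_limit_module (he : IsCoherentOn I Set.univ e)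
    {s : OmegaOne → OmegaOne → R} (hs₁ : ∀ σ, s σ σ = 1)
    (hs : ∀ σ ρ κ, σ ≤ ρ → ρ ≤ κ → s σ ρ * s ρ κ = s σ κ)
    (hsI : ∀ σ ρ x, σ ≤ ρ → (s σ ρ * x ∈ I ρ ↔ x ∈ I σ)) :
    ∃ (U : Type u) (_ : AddCommGroup U) (_ : Module R U) (w : OmegaOne → U),
      (∀ σ ρ, σ ≤ ρ → w σ = (s σ ρ * e ρ σ : R) • w ρ) ∧
      (∀ ν (x : R), x • w ν = 0 ↔ x ∈ I ν) ∧ ∀ z, ∃ ν, ∃ x : R, z = x • w ν := by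
  classical
  let f : ∀ σ ρ : OmegaOne, σ ≤ ρ → (R ⧸ I σ) →ₗ[R] (R ⧸ I ρ) := fun σ ρ h =>
    (I σ).liftQ (LinearMap.toSpanSingleton R (R ⧸ I ρ) ((I ρ).mkQ (s σ ρ * e ρ σ))) (by
      intro x hx
      rw [LinearMap.mem_ker, LinearMap.toSpanSingleton_apply, ← map_smul, Submodule.mkQ_apply,
        Submodule.Quotient.mk_eq_zero, smul_eq_mul, mul_left_comm]
      exact (hsI σ ρ _ h).mpr ((I σ).mul_mem_right _ hx))
  have hf : ∀ σ ρ h x, f σ ρ h ((I σ).mkQ x) = (I ρ).mkQ (x * (s σ ρ * e ρ σ)) := by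
    intro σ ρ h x
    simp only [f, Submodule.mkQ_apply, Submodule.liftQ_apply, LinearMap.toSpanSingleton_apply]
    rfl
  have hdir : DirectedSystem (fun σ => R ⧸ I σ) (f · · ·) := by
    constructor
    · intro σ x
      obtain ⟨x, rfl⟩ := (I σ).mkQ_surjective x
      rw [hf σ σ le_rfl, hs₁, he.self σ trivial, Units.val_one, mul_one, mul_one]
    · intro κ ρ σ h1 h2 x
      obtain ⟨x, rfl⟩ := (I σ).mkQ_surjective x
      rw [hf σ ρ h1, hf ρ κ h2, hf σ κ (h1.trans h2), ← sub_eq_zero, ← map_sub, Submodule.mkQ_apply,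
        Submodule.Quotient.mk_eq_zero]
      have := (hsI σ κ _ (h1.trans h2)).mpr
        ((I σ).mul_mem_left x (he.comp σ ρ κ h1 h2 trivial))
      convert this using 1
      rw [← hs σ ρ κ h1 h2]
      ring
  have hof : ∀ ν x, x • Module.DirectLimit.of R OmegaOne (fun σ => R ⧸ I σ) f ν ((I ν).mkQ 1) =
      Module.DirectLimit.of R OmegaOne (fun σ => R ⧸ I σ) f ν ((I ν).mkQ x) := by
    intro ν x
    rw [← map_smul, ← map_smul, smul_eq_mul, mul_one]
  refine ⟨Module.DirectLimit (fun σ => R ⧸ I σ) f, inferInstance, inferInstance,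
    fun ν => Module.DirectLimit.of R OmegaOne (fun σ => R ⧸ I σ) f ν ((I ν).mkQ 1), ?_, ?_, ?_⟩
  · intro σ ρ h
    refine Eq.trans ?_ (hof ρ _).symm
    have := Module.DirectLimit.of_f (R := R) (f := f) (hij := h) (x := (I σ).mkQ 1)
    rw [hf σ ρ h, one_mul] at this
    exact this.symm
  · intro ν x
    rw [hof]
    constructor
    · intro h
      -- The transition maps are injective by `hsI`, so annihilators do not grow in the limit.
      obtain ⟨κ, hκ, h⟩ := Module.DirectLimit.of.zero_exact h
      rw [hf ν κ hκ, Submodule.mkQ_apply, Submodule.Quotient.mk_eq_zero, mul_left_comm,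
        hsI ν κ _ hκ] at h
      exact (Ideal.mul_unit_mem_iff_mem _ (e κ ν).isUnit).mp h
    · intro h
      rw [Submodule.mkQ_apply, (Submodule.Quotient.mk_eq_zero _).mpr h, map_zero]
  · intro z
    obtain ⟨ν, y, rfl⟩ := Module.DirectLimit.exists_of z
    obtain ⟨x, rfl⟩ := (I ν).mkQ_surjective y
    exact ⟨ν, x, (hof ν x).symm⟩

variable {U : Type u} [AddCommGroup U] [Module R U] {w : OmegaOne → U}
  {s : OmegaOne → OmegaOne → R}

theorem exists_eq_smul_of_le
    (hw : ∀ σ ρ, σ ≤ ρ → w σ = (s σ ρ * e ρ σ : R) • w ρ) (hspan : ∀ z, ∃ ν, ∃ x : R, z = x • w ν)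
    (μ : OmegaOne) (z : U) : ∃ ν, μ ≤ ν ∧ ∃ x : R, z = x • w ν := by
  obtain ⟨ν, x, rfl⟩ := hspan z
  exact ⟨max μ ν, le_max_left _ _, _, by rw [hw ν _ (le_max_right μ ν), smul_smul]⟩

theorem isUniserial_of_chain [IsDomain R] [ValuationRing R]
    (hw : ∀ σ ρ, σ ≤ ρ → w σ = (s σ ρ * e ρ σ : R) • w ρ)
    (hspan : ∀ z, ∃ ν, ∃ x : R, z = x • w ν) : IsUniserial R U := by
  intro M N
  by_contra! h
  obtain ⟨hMN, hNM⟩ := h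
  obtain ⟨z, hzM, hzN⟩ := SetLike.not_le_iff_exists.mp hMN
  obtain ⟨y, hyN, hyM⟩ := SetLike.not_le_iff_exists.mp hNM
  obtain ⟨μ, x, rfl⟩ := hspan z
  obtain ⟨ν, hμν, x', rfl⟩ := exists_eq_smul_of_le hw hspan μ y
  rw [hw μ ν hμν, smul_smul] at hzM hzN
  rcases ValuationRing.dvd_total (x * (s μ ν * e ν μ)) x' with ⟨t, rfl⟩ | ⟨t, ht⟩
  · rw [mul_comm, mul_smul] at hyM
    exact hyM (M.smul_mem t hzM)
  · rw [ht, mul_comm, mul_smul] at hzN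
    exact hzN (N.smul_mem t hyN)

end LimitModule

/-! ### The ideals R ∩ r_ν A and the ratios r_ν / r_μ -/

section Scaled

variable {R : Type u} {Q : Type v} [CommRing R] [Field Q] [Algebra R Q]

theorem mem_scaled {q : Q} (hq : q ≠ 0) {A : Submodule R Q} {y : Q} :
    y ∈ scaled q A ↔ q⁻¹ * y ∈ A := by
  constructor
  · rintro ⟨a, ha, rfl⟩
    rw [LinearMap.mulLeft_apply, inv_mul_cancel_left₀ hq]
    exact ha
  · intro h
    exact ⟨_, h, by rw [LinearMap.mulLeft_apply, mul_inv_cancel_left₀ hq]⟩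

theorem nonempty_stdModule_scaled {q : Q} (hq : q ≠ 0) (J A : Submodule R Q) :
    Nonempty (StdModule J A ≃ₗ[R] StdModule (scaled q J) (scaled q A)) := by
  refine ⟨Submodule.Quotient.equiv _ _
    (Submodule.equivMapOfInjective (LinearMap.mulLeft R q) (mul_right_injective₀ hq) J) ?_⟩
  ext ⟨y, hy⟩
  rw [Submodule.mem_map]
  constructor
  · rintro ⟨x, hx, h⟩
    rw [← h]
    exact ⟨x, hx, rfl⟩
  · rintro ⟨x, hx, h⟩
    have hyJ := (mem_scaled hq).mp hy
    have hxy : x = q⁻¹ * y := by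
      rw [← show q * x = y from h, inv_mul_cancel_left₀ hq]
    exact ⟨⟨q⁻¹ * y, hyJ⟩, hxy ▸ hx, Subtype.ext (mul_inv_cancel_left₀ hq y)⟩

/-- The ideal `R ∩ r_ν A`. -/
def scaledIdeal (A : Submodule R Q) (r : OmegaOne → Q) (ν : OmegaOne) : Ideal R :=
  Submodule.comap (Algebra.linearMap R Q) (scaled (r ν) A)

variable {J A : Submodule R Q} {r : OmegaOne → Q}

theorem mem_scaledIdeal (hr : IsPresentation J r) {ν : OmegaOne} {x : R} :
    x ∈ scaledIdeal A r ν ↔ (r ν)⁻¹ * algebraMap R Q x ∈ A :=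
  mem_scaled (hr.ne_zero ν)

/-- The ratios `r_ν / r_μ`, as elements of `R`. -/
theorem IsPresentation.exists_ratio (hr : IsPresentation J r) :
    ∃ s : OmegaOne → OmegaOne → R, ∀ μ ν, μ ≤ ν → r ν = algebraMap R Q (s μ ν) * r μ := by
  have : ∀ μ ν, ∃ c : R, μ ≤ ν → r ν = algebraMap R Q c * r μ := by
    intro μ ν
    rcases lt_trichotomy μ ν with h | rfl | h
    · obtain ⟨c, hc⟩ := hr.dvd μ ν h
      exact ⟨c, fun _ => by rw [hc, Algebra.smul_def]⟩
    · exact ⟨1, fun _ => by rw [map_one, one_mul]⟩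
    · exact ⟨0, fun h' => absurd h h'.not_gt⟩
  choose s hs using this
  exact ⟨s, hs⟩

theorem scaled_antitone (hr : IsPresentation J r) (A : Submodule R Q) :
    Antitone fun ν => scaled (r ν) A := by
  intro μ ν h y hy
  obtain ⟨s, hs⟩ := hr.exists_ratio
  obtain ⟨a, ha, rfl⟩ := hy
  refine ⟨s μ ν • a, A.smul_mem _ ha, ?_⟩
  rw [LinearMap.mulLeft_apply, LinearMap.mulLeft_apply, hs μ ν h, Algebra.smul_def]
  ring

theorem scaledIdeal_antitone (hr : IsPresentation J r) (A : Submodule R Q) :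
    Antitone (scaledIdeal A r) :=
  fun _ _ h => Submodule.comap_mono (scaled_antitone hr A h)

theorem mem_invSpan {q y : Q} : y ∈ invSpan R q ↔ ∃ t : R, y = algebraMap R Q t * q⁻¹ := by
  simp only [invSpan, Submodule.mem_span_singleton, Algebra.smul_def, eq_comm]

theorem IsPresentation.monotone (hr : IsPresentation J r) : Monotone fun ν => invSpan R (r ν) := by
  intro μ ν h
  obtain ⟨s, hs⟩ := hr.exists_ratio
  change Submodule.span R {(r μ)⁻¹} ≤ _
  rw [Submodule.span_singleton_le_iff_mem, mem_invSpan]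
  have h1 := hr.ne_zero ν
  rw [hs μ ν h] at h1
  have h2 := left_ne_zero_of_mul h1
  have h3 := right_ne_zero_of_mul h1
  refine ⟨s μ ν, ?_⟩
  rw [hs μ ν h]
  field_simp

theorem IsPresentation.exists_mem (hr : IsPresentation J r) (μ : OmegaOne) {y : Q} (hy : y ∈ J) :
    ∃ ν, μ ≤ ν ∧ ∃ t : R, y = algebraMap R Q t * (r ν)⁻¹ := by
  rw [hr.eq_iSup, Submodule.mem_iSup_of_directed _ hr.monotone.directed_le] at hy
  obtain ⟨ν, hν⟩ := hy
  exact ⟨max μ ν, le_max_left _ _, mem_invSpan.mp (hr.monotone (le_max_right μ ν) hν)⟩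

theorem IsPresentation.inv_mem (hr : IsPresentation J r) (ν : OmegaOne) : (r ν)⁻¹ ∈ J := by
  rw [hr.eq_iSup]
  exact (le_iSup (fun ν => invSpan R (r ν)) ν) (Submodule.mem_span_singleton_self _)

/-- There is a first `ν` for which `r_ν A` does not contain `1`. -/
theorem IsPresentation.exists_first (hr : IsPresentation J r) (hAJ : A < J) :
    ∃ ν₀, scaledIdeal A r ν₀ ≠ ⊤ ∧ ∀ σ < ν₀, scaledIdeal A r σ = ⊤ := by
  have hne : {ν | scaledIdeal A r ν ≠ ⊤}.Nonempty := by
    obtain ⟨y, hyJ, hyA⟩ := SetLike.exists_of_lt hAJ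
    obtain ⟨ν, -, t, rfl⟩ := hr.exists_mem (Classical.arbitrary _) hyJ
    refine ⟨ν, fun h => hyA ?_⟩
    have h1 : (1 : R) ∈ scaledIdeal A r ν := h ▸ Submodule.mem_top
    rw [mem_scaledIdeal hr, map_one, mul_one] at h1
    rw [← Algebra.smul_def]
    exact A.smul_mem t h1
  exact ⟨wellFounded_lt.min _ hne, wellFounded_lt.min_mem _ hne, fun σ hσ =>
    not_not.mp fun h => wellFounded_lt.not_lt_min {ν | scaledIdeal A r ν ≠ ⊤} h hσ⟩

end Scaled

/-! ### Type and non-standardness of the limit module -/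

section TypeOfModule

variable {R : Type u} {Q : Type v} [CommRing R] [IsDomain R] [ValuationRing R]
  [Field Q] [Algebra R Q] [IsFractionRing R Q] {J A : Submodule R Q} {r : OmegaOne → Q}

/-- Two elements of `Q` are comparable with respect to divisibility over `R`. -/
theorem exists_eq_mul_or (R : Type u) {Q : Type v} [CommRing R] [IsDomain R] [ValuationRing R]
    [Field Q] [Algebra R Q] [IsFractionRing R Q] (x y : Q) :
    ∃ t : R, x = algebraMap R Q t * y ∨ y = algebraMap R Q t * x := by
  obtain ⟨a, b, hb, rfl⟩ := IsFractionRing.div_surjective (A := R) x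
  obtain ⟨c, d, hd, rfl⟩ := IsFractionRing.div_surjective (A := R) y
  have hb' : algebraMap R Q b ≠ 0 := by
    simpa using nonZeroDivisors.ne_zero hb
  have hd' : algebraMap R Q d ≠ 0 := by
    simpa using nonZeroDivisors.ne_zero hd
  rcases ValuationRing.dvd_total (c * b) (a * d) with ⟨t, ht⟩ | ⟨t, ht⟩
  · refine ⟨t, Or.inl ?_⟩
    have := congrArg (algebraMap R Q) ht
    simp only [map_mul] at this
    field_simp
    linear_combination this
  · refine ⟨t, Or.inr ?_⟩
    have := congrArg (algebraMap R Q) ht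
    simp only [map_mul] at this
    field_simp
    linear_combination this

/-- An element outside `R` has its inverse in `R`, which would put 1 into `r_ν A`. -/
theorem scaled_le_range {ν : OmegaOne} (h : scaledIdeal A r ν ≠ ⊤) {y : Q}
    (hy : y ∈ scaled (r ν) A) : ∃ x : R, algebraMap R Q x = y := by
  obtain ⟨t, ht | ht⟩ := exists_eq_mul_or R y 1
  · exact ⟨t, by rw [ht, mul_one]⟩
  · refine absurd ((Ideal.eq_top_iff_one _).mpr ?_) h
    change algebraMap R Q 1 ∈ scaled (r ν) A
    rw [map_one, ht, ← Algebra.smul_def]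
    exact Submodule.smul_mem _ _ hy

variable {e : OmegaOne → OmegaOne → Rˣ} {s : OmegaOne → OmegaOne → R}
  {U : Type u} [AddCommGroup U] [Module R U] {w : OmegaOne → U}

theorem annIn_eq_scaled
    (hann : ∀ ν (x : R), x • w ν = 0 ↔ x ∈ scaledIdeal A r ν) {ν : OmegaOne}
    (h : scaledIdeal A r ν ≠ ⊤) : annIn (R := R) Q (w ν) = scaled (r ν) A := by
  ext y
  constructor
  · rintro ⟨x, hx, rfl⟩
    exact (hann ν x).mp ((Ideal.mem_torsionOf_iff _ _).mp hx)
  · intro hy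
    obtain ⟨x, rfl⟩ := scaled_le_range h hy
    exact ⟨x, (Ideal.mem_torsionOf_iff _ _).mpr ((hann ν x).mpr hy), rfl⟩

theorem divSubmodule_eq_scaled (hr : IsPresentation J r)
    (hs : ∀ μ ν, μ ≤ ν → r ν = algebraMap R Q (s μ ν) * r μ)
    (hw : ∀ σ ρ, σ ≤ ρ → w σ = (s σ ρ * e ρ σ : R) • w ρ)
    (hsI : ∀ σ ρ x, σ ≤ ρ → (s σ ρ * x ∈ scaledIdeal A r ρ ↔ x ∈ scaledIdeal A r σ))
    (hann : ∀ ν (x : R), x • w ν = 0 ↔ x ∈ scaledIdeal A r ν)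
    (hspan : ∀ z, ∃ ν, ∃ x : R, z = x • w ν) {ν₀ : OmegaOne}
    (h : scaledIdeal A r ν₀ ≠ ⊤) : divSubmodule (R := R) Q (w ν₀) = scaled (r ν₀) J := by
  have hs0 : ∀ ν, ν₀ ≤ ν → algebraMap R Q (s ν₀ ν) ≠ 0 := fun ν hν => by
    have := hr.ne_zero ν
    rw [hs ν₀ ν hν] at this
    exact left_ne_zero_of_mul this
  ext y
  rw [mem_scaled (hr.ne_zero ν₀)]
  constructor
  · rintro ⟨d, hd, ⟨b, hb⟩, t, rfl⟩
    obtain ⟨ν, hν, x, rfl⟩ := exists_eq_smul_of_le hw hspan ν₀ b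
    -- In the other case `d = s ν₀ ν * m`; cancelling `s ν₀ ν` gives `m * x ≡ e ν ν₀` modulo the
    -- proper ideal at `ν₀`, so `m` is a unit.
    have hdvd : d ∣ s ν₀ ν := by
      rcases ValuationRing.dvd_total d (s ν₀ ν) with h' | ⟨m, rfl⟩
      · exact h'
      · rw [hw ν₀ ν hν, ← sub_eq_zero, smul_smul, ← sub_smul, hann, mul_assoc, ← mul_sub,
          hsI ν₀ ν _ hν] at hb
        have hm := isUnit_of_mul_isUnit_left (isUnit_of_sub_mem h (e ν ν₀).isUnit hb)
        exact hm.mul_right_dvd.mpr dvd_rfl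
    obtain ⟨m, hm⟩ := hdvd
    have hd' : algebraMap R Q d ≠ 0 := by simpa using hd
    have : (r ν₀)⁻¹ * ((algebraMap R Q d)⁻¹ * algebraMap R Q t) = (m * t) • (r ν)⁻¹ := by
      have h1 := hs0 ν hν
      rw [hm, map_mul] at h1
      have h2 := right_ne_zero_of_mul h1
      rw [hs ν₀ ν hν, hm, Algebra.smul_def, map_mul, map_mul]
      have := hr.ne_zero ν₀
      field_simp
    rw [this]
    exact J.smul_mem _ (hr.inv_mem ν)
  · intro hy
    obtain ⟨ν, hν, t, ht⟩ := hr.exists_mem ν₀ hy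
    refine ⟨s ν₀ ν, fun h0 => hs0 ν hν (by rw [h0, map_zero]),
      ⟨(e ν ν₀ : R) • w ν, by rw [hw ν₀ ν hν, smul_smul]⟩, t, ?_⟩
    have h1 := hs0 ν hν
    have h2 := hr.ne_zero ν₀
    rw [hs ν₀ ν hν] at ht
    field_simp at ht ⊢
    exact ht

/-- If the limit module is standard, the coherent system has a cofinal branch. -/
theorem exists_cofinalBranch_of_isStandard (hr : IsPresentation J r)
    (hs : ∀ μ ν, μ ≤ ν → r ν = algebraMap R Q (s μ ν) * r μ)
    (hw : ∀ σ ρ, σ ≤ ρ → w σ = (s σ ρ * e ρ σ : R) • w ρ)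
    (hann : ∀ ν (x : R), x • w ν = 0 ↔ x ∈ scaledIdeal A r ν) {ν₀ : OmegaOne}
    (h : scaledIdeal A r ν₀ ≠ ⊤) (hmin : ∀ σ < ν₀, scaledIdeal A r σ = ⊤)
    (hstd : IsStandard R Q U) : ∃ c, IsCofinalBranch (scaledIdeal A r) e c := by
  obtain ⟨J', A', -, ⟨φ⟩⟩ := hstd
  have hIne : ∀ ν, ν₀ ≤ ν → scaledIdeal A r ν ≠ ⊤ := fun ν hν h' =>
    h (top_le_iff.mp (h' ▸ scaledIdeal_antitone hr A hν))
  choose p hp using fun ν => (A'.submoduleOf J').mkQ_surjective (φ (w ν))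
  have hA' : ∀ z : J', (A'.submoduleOf J').mkQ z = 0 ↔ (z : Q) ∈ A' := fun z => by
    rw [Submodule.mkQ_apply, Submodule.Quotient.mk_eq_zero]
    rfl
  have hann' : ∀ ν (x : R), algebraMap R Q x * (p ν : Q) ∈ A' ↔ x ∈ scaledIdeal A r ν := by
    intro ν x
    rw [← hann, ← φ.map_eq_zero_iff, map_smul, ← hp, ← map_smul, hA', Submodule.coe_smul,
      Algebra.smul_def]
  have hdiff : ∀ σ ρ, σ ≤ ρ →
      algebraMap R Q (s σ ρ * e ρ σ) * (p ρ : Q) - (p σ : Q) ∈ A' := by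
    intro σ ρ hσρ
    have := (hA' ((s σ ρ * e ρ σ : R) • p ρ - p σ)).mp (by
      rw [map_sub, map_smul, hp, hp, ← map_smul, ← hw σ ρ hσρ, sub_self])
    rwa [Submodule.coe_sub, Submodule.coe_smul, Algebra.smul_def] at this
  have hpA : ∀ ν, ν₀ ≤ ν → (p ν : Q) ∉ A' := fun ν hν hmem =>
    hIne ν hν ((Ideal.eq_top_iff_one _).mpr ((hann' ν 1).mp (by rwa [map_one, one_mul])))
  have hp0 : ∀ ν, ν₀ ≤ ν → (p ν : Q) ≠ 0 := fun ν hν h0 => hpA ν hν (h0 ▸ A'.zero_mem)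
  -- The error in `hdiff` is a multiple `t * p σ`, since otherwise `p σ` would lie in `A'`; by
  -- `hann'` the factor `t` is in the ideal at `σ`. Hence the ratios of `r ν * p ν` to `r ν₀ * p ν₀`
  -- are units of `R`, and they form the branch.
  have hkey : ∀ σ ρ, ν₀ ≤ σ → σ ≤ ρ → ∃ y ∈ scaledIdeal A r σ,
      algebraMap R Q (e ρ σ) * (r ρ * p ρ) = algebraMap R Q (1 + y) * (r σ * p σ) := by
    intro σ ρ hσ hσρ
    obtain ⟨t, ht | ht⟩ := exists_eq_mul_or R
      (algebraMap R Q (s σ ρ * e ρ σ) * (p ρ : Q) - (p σ : Q)) (p σ : Q)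
    · refine ⟨t, (hann' σ t).mp (ht ▸ hdiff σ ρ hσρ), ?_⟩
      rw [hs σ ρ hσρ, map_add, map_one]
      rw [map_mul] at ht
      linear_combination (r σ) * ht
    · refine absurd ?_ (hpA σ hσ)
      rw [ht, ← Algebra.smul_def]
      exact A'.smul_mem _ (hdiff σ ρ hσρ)
  have hc : ∀ ν, ∃ c : Rˣ, ν₀ ≤ ν →
      r ν * p ν = algebraMap R Q c * (r ν₀ * p ν₀) := by
    intro ν
    by_cases hν : ν₀ ≤ ν
    · obtain ⟨y, hy, hyeq⟩ := hkey ν₀ ν le_rfl hν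
      have hu : IsUnit (1 + y) := isUnit_of_sub_mem h isUnit_one (by rwa [add_sub_cancel_left])
      refine ⟨(e ν ν₀)⁻¹ * hu.unit, fun _ => ?_⟩
      rw [Units.val_mul, IsUnit.unit_spec, map_mul, mul_assoc, ← hyeq, ← mul_assoc, ← map_mul,
        Units.inv_mul, map_one, one_mul]
    · exact ⟨1, fun h' => absurd h' hν⟩
  choose c hc using hc
  refine ⟨c, fun σ ρ hσρ => ?_⟩
  rcases lt_or_ge σ ν₀ with hσ | hσ
  · rw [hmin σ hσ]
    exact Submodule.mem_top
  · obtain ⟨y, hy, hyeq⟩ := hkey σ ρ hσ hσρ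
    rw [hc ρ (hσ.trans hσρ), hc σ hσ, ← mul_assoc (algebraMap R Q (e ρ σ)), ← mul_assoc (algebraMap R Q (1 + y)),
      ← map_mul, ← map_mul] at hyeq
    have hne : r ν₀ * (p ν₀ : Q) ≠ 0 := mul_ne_zero (hr.ne_zero ν₀) (hp0 ν₀ le_rfl)
    have := IsFractionRing.injective R Q (mul_right_cancel₀ hne hyeq)
    have h2 := (scaledIdeal A r σ).mul_mem_right (c σ : R) hy
    convert h2 using 1
    linear_combination this

/-- A coherent system without cofinal branch gives a non-standard uniserial module. -/
theorem IsCoherentOn.exists_nonstandard (hr : IsPresentation J r)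
    (hAJ : A < J) (he : IsCoherentOn (scaledIdeal A r) Set.univ e)
    (hbr : ∀ c, ¬ IsCofinalBranch (scaledIdeal A r) e c) :
    ∃ (U : Type u) (_ : AddCommGroup U) (_ : Module R U),
      IsUniserial R U ∧ IsOfType U J A ∧ ¬ IsStandard R Q U := by
  obtain ⟨s, hs⟩ := hr.exists_ratio
  obtain ⟨ν₀, h, hmin⟩ := hr.exists_first hAJ
  have hs₁ : ∀ σ, s σ σ = 1 := by
    intro σ
    apply IsFractionRing.injective R Q
    have := hs σ σ le_rfl
    rw [map_one]
    exact (mul_eq_right₀ (hr.ne_zero σ)).mp this.symm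
  have hs₂ : ∀ σ ρ κ, σ ≤ ρ → ρ ≤ κ → s σ ρ * s ρ κ = s σ κ := by
    intro σ ρ κ h1 h2
    apply IsFractionRing.injective R Q
    apply mul_right_cancel₀ (hr.ne_zero σ)
    rw [← hs σ κ (h1.trans h2), hs ρ κ h2, hs σ ρ h1, map_mul]
    ring
  have hsI : ∀ σ ρ x, σ ≤ ρ → (s σ ρ * x ∈ scaledIdeal A r ρ ↔ x ∈ scaledIdeal A r σ) := by
    intro σ ρ x hσρ
    rw [mem_scaledIdeal hr, mem_scaledIdeal hr]
    have h0 := hr.ne_zero ρ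
    rw [hs σ ρ hσρ] at h0 ⊢
    have h1 := left_ne_zero_of_mul h0
    have h2 := right_ne_zero_of_mul h0
    rw [map_mul, mul_inv_rev, mul_assoc, inv_mul_cancel_left₀ h1]
  obtain ⟨U, i1, i2, w, hw, hann, hspan⟩ := he.exists_limit_module hs₁ hs₂ hsI
  refine ⟨U, i1, i2, isUniserial_of_chain hw hspan, ⟨w ν₀, fun h0 => h ?_, ?_⟩, fun hstd => ?_⟩
  · exact (Ideal.eq_top_iff_one _).mpr ((hann ν₀ 1).mp (by rw [h0, smul_zero]))
  · rw [annIn_eq_scaled hann h, divSubmodule_eq_scaled hr hs hw hsI hann hspan h]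
    exact nonempty_stdModule_scaled (hr.ne_zero ν₀) J A
  · obtain ⟨c, hc⟩ := exists_cofinalBranch_of_isStandard hr hs hw hann h hmin hstd
    exact hbr c hc

end TypeOfModule

/-! ### Translation of the hypotheses and conclusion -/

section Hypotheses

variable {R : Type u} {Q : Type v} [CommRing R] [Field Q] [Algebra R Q]
  {J A : Submodule R Q} {r : OmegaOne → Q}

theorem colonIdeal_le_scaledIdeal (hr : IsPresentation J r) {σ δ : OmegaOne} (h : σ < δ) :
    colonIdeal A r δ ≤ scaledIdeal A r σ := by
  intro x hx
  rw [mem_scaledIdeal hr, mul_comm]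
  exact Submodule.mem_div_iff_forall_mul_mem.mp hx _
    (le_iSup (fun ν : Set.Iio δ => invSpan R (r ν)) ⟨σ, h⟩ (Submodule.mem_span_singleton_self _))

theorem mkQ_nhdSubmodule_eq_iff (hr : IsPresentation J r) {σ δ : OmegaOne} (h : σ < δ) (x y : R) :
    (nhdSubmodule A r δ σ).mkQ ((colonIdeal A r δ).mkQ x) =
      (nhdSubmodule A r δ σ).mkQ ((colonIdeal A r δ).mkQ y) ↔ x - y ∈ scaledIdeal A r σ := by
  rw [← sub_eq_zero, ← map_sub, ← map_sub, Submodule.mkQ_apply (nhdSubmodule A r δ σ),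
    Submodule.Quotient.mk_eq_zero]
  constructor
  · rintro ⟨z, hz, h'⟩
    have h1 : z - (x - y) ∈ colonIdeal A r δ := (Submodule.Quotient.eq _).mp h'
    have h2 := (scaledIdeal A r σ).sub_mem hz (colonIdeal_le_scaledIdeal hr h h1)
    rwa [sub_sub_cancel] at h2
  · intro h'
    exact ⟨x - y, h', rfl⟩

/-- If `R/(A : J_δ)` is not complete, there is a Cauchy family in `R` without limit. -/
theorem exists_cauchy_of_not_isCompleteAt (hr : IsPresentation J r) {δ : OmegaOne}
    (hδ : ¬ IsMin δ) (h : ¬ IsCompleteAt A r δ) :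
    ∃ ξ, IsCauchyBelow (scaledIdeal A r) δ ξ ∧ ∀ z, ∃ σ < δ, z - ξ σ ∉ scaledIdeal A r σ := by
  by_contra! hcon
  obtain ⟨μ, hμ⟩ := not_isMin_iff.mp hδ
  have : Nonempty (Set.Iio δ) := ⟨⟨μ, hμ⟩⟩
  refine h ?_
  unfold IsCompleteAt
  refine @CompleteSpace.mk _ (_) fun {l} hl => ?_
  have hl0 : l.NeBot := hl.1
  rw [cauchy_iInf_uniformSpace] at hl
  -- A Cauchy filter is eventually constant in each discrete quotient; representatives of these
  -- constants form the Cauchy family in `R`.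
  have hpure : ∀ σ : Set.Iio δ, ∃ v, l.map (nhdSubmodule A r δ σ).mkQ = pure v := fun σ =>
    @DiscreteUniformity.eq_pure_of_cauchy _ ⊥ (@DiscreteUniformity.mk _ ⊥ rfl) _
      (cauchy_comap_uniformSpace.mp (hl σ))
  have hrep : ∀ σ : OmegaOne, ∃ x : R, σ < δ → ∀ᶠ m in l, (nhdSubmodule A r δ σ).mkQ m =
      (nhdSubmodule A r δ σ).mkQ ((colonIdeal A r δ).mkQ x) := by
    intro σ
    by_cases hσ : σ < δ
    · obtain ⟨v, hv⟩ := hpure ⟨σ, hσ⟩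
      obtain ⟨m, rfl⟩ := (nhdSubmodule A r δ σ).mkQ_surjective v
      obtain ⟨x, rfl⟩ := (colonIdeal A r δ).mkQ_surjective m
      refine ⟨x, fun _ => ?_⟩
      have hmem : {(nhdSubmodule A r δ σ).mkQ ((colonIdeal A r δ).mkQ x)} ∈
          l.map (nhdSubmodule A r δ σ).mkQ := hv ▸ Filter.mem_pure.mpr rfl
      exact hmem
    · exact ⟨0, fun h' => absurd h' hσ⟩
  choose ξ hξ using hrep
  have hcau : IsCauchyBelow (scaledIdeal A r) δ ξ := by
    intro σ ρ h1 h2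
    obtain ⟨m, hm, hm'⟩ := ((hξ σ (h1.trans_lt h2)).and (hξ ρ h2)).exists
    obtain ⟨x, rfl⟩ := (colonIdeal A r δ).mkQ_surjective m
    have e1 := (mkQ_nhdSubmodule_eq_iff hr (h1.trans_lt h2) _ _).mp hm
    have e2 := scaledIdeal_antitone hr A h1 ((mkQ_nhdSubmodule_eq_iff hr h2 _ _).mp hm')
    have := (scaledIdeal A r σ).sub_mem e1 e2
    rwa [sub_sub_sub_cancel_left] at this
  obtain ⟨z, hz⟩ := hcon ξ hcau
  refine ⟨(colonIdeal A r δ).mkQ z, ?_⟩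
  rw [UniformSpace.toTopologicalSpace_iInf, nhds_iInf, le_iInf_iff]
  intro σ
  rw [UniformSpace.toTopologicalSpace_comap, @nhds_induced _ _ (⊥ : UniformSpace _).toTopologicalSpace, ← Filter.map_le_iff_le_comap]
  have hle : l.map (nhdSubmodule A r δ σ).mkQ ≤
      pure ((nhdSubmodule A r δ σ).mkQ ((colonIdeal A r δ).mkQ z)) := by
    rw [Filter.le_pure_iff, Filter.mem_map]
    filter_upwards [hξ σ σ.2] with m hm
    exact hm.trans ((mkQ_nhdSubmodule_eq_iff hr σ.2 _ _).mpr (hz σ σ.2)).symm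
  exact hle.trans (@pure_le_nhds _ (⊥ : UniformSpace _).toTopologicalSpace _)

/-- Otherwise, sending each coset to an element of `S` congruent to it would embed the uncountable
quotient in `S`. -/
theorem exists_sub_notMem_of_uncountable {μ ν : OmegaOne}
    (hle : ∀ y ∈ scaled (r ν) A, ∃ x : R, algebraMap R Q x = y)
    (h : Uncountable (StdModule (scaled (r ν) A) (scaled (r μ) A))) {S : Set R} (hS : S.Countable) :
    ∃ x ∈ scaledIdeal A r ν, ∀ s ∈ S, x - s ∉ scaledIdeal A r μ := by
  by_contra! hcon
  choose! f hfS hf using hcon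
  have hrep : ∀ z : StdModule (scaled (r ν) A) (scaled (r μ) A), ∃ x : R,
      ∃ hx : algebraMap R Q x ∈ scaled (r ν) A,
        ((scaled (r μ) A).submoduleOf (scaled (r ν) A)).mkQ ⟨_, hx⟩ = z := by
    intro z
    obtain ⟨⟨y, hy⟩, rfl⟩ := Submodule.mkQ_surjective _ z
    obtain ⟨x, rfl⟩ := hle y hy
    exact ⟨x, hy, rfl⟩
  choose x hx hxz using hrep
  have : Countable S := hS.to_subtype
  have hinj : Function.Injective
      fun z : StdModule (scaled (r ν) A) (scaled (r μ) A) => (⟨f (x z), hfS _ (hx z)⟩ : S) := by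
    intro z z' heq
    have heq' : f (x z) = f (x z') := congrArg Subtype.val heq
    rw [← hxz z, ← hxz z']
    refine (Submodule.Quotient.eq _).mpr ?_
    have e1 := (scaledIdeal A r μ).sub_mem (hf _ (hx z)) (heq' ▸ hf _ (hx z'))
    rw [sub_sub_sub_cancel_right] at e1
    have e2 : algebraMap R Q (x z - x z') ∈ scaled (r μ) A := e1
    rw [map_sub] at e2
    exact e2
  exact h.not_countable hinj.countable

end Hypotheses

theorem corollary9 {R : Type u} {Q : Type v} [CommRing R] [IsDomain R] [ValuationRing R]
    [Field Q] [Algebra R Q] [IsFractionRing R Q]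
    (hR : Cardinal.mk R = Cardinal.aleph 1)
    (J A : Submodule R Q) (hAJ : A < J)
    (r : OmegaOne → Q) (hr : IsPresentation J r)
    (hunc : IsEssentiallyUncountable A r)
    (hΓ : gammaInvariant A r = 1) :
    ∃ (U : Type u) (_ : AddCommGroup U) (_ : Module R U),
      IsUniserial R U ∧ IsOfType U J A ∧ ¬ IsStandard R Q U := by
  suffices h : ∃ e : OmegaOne → OmegaOne → Rˣ, IsCoherentOn (scaledIdeal A r) Set.univ e ∧
      ∀ c, ¬ IsCofinalBranch (scaledIdeal A r) e c by
    obtain ⟨e, he, hbr⟩ := h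
    exact he.exists_nonstandard hr hAJ hbr
  have hI := scaledIdeal_antitone hr A
  -- The first case rests on `hΓ`, the second on `hunc`.
  rcases le_or_gt Cardinal.continuum.{0} (Cardinal.aleph 1) with hCH | hCH
  · obtain ⟨C, hC, hCS⟩ := (ClubClass.mk_eq_one_iff _).mp hΓ
    exact exists_coherent_of_continuum_le hI hCH hR.le hC fun δ hδ =>
      exists_cauchy_of_not_isCompleteAt hr (hCS hδ).1.1 (hCS hδ).2
  · obtain ⟨ν₀, htop, -⟩ := hr.exists_first hAJ
    have hlt : Cardinal.mk R < Cardinal.continuum := by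
      have h := Cardinal.lift_lt.{0, u}.mpr hCH
      rwa [Cardinal.lift_aleph, Ordinal.lift_one, Cardinal.lift_continuum, ← hR] at h
    obtain ⟨g, hg⟩ : ∃ g : OmegaOne → R, Function.Surjective g := by
      have h : Cardinal.lift.{0} (Cardinal.mk R) = Cardinal.lift.{u} (Cardinal.mk OmegaOne) := by
        rw [hR, OmegaOne.mk_eq, Cardinal.lift_aleph, Cardinal.lift_aleph, Ordinal.lift_one,
          Ordinal.lift_one]
      obtain ⟨g⟩ := Cardinal.lift_mk_eq'.mp h
      exact ⟨g.symm, g.symm.surjective⟩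
    refine exists_coherent_of_lt_continuum hI hlt hg htop fun ν hν => ?_
    obtain ⟨μ, -, hμ⟩ := hunc ν
    have hne : scaledIdeal A r ν ≠ ⊤ := fun h => htop (top_le_iff.mp (h ▸ hI hν))
    exact ⟨μ, fun S hS => exists_sub_notMem_of_uncountable
      (fun y hy => scaled_le_range hne hy) hμ hS⟩
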